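/- Let $L,d>0$, let $E_1>E_2>0$, let $0<\nu<\tfrac12$ with $\nu:=\nu_{12}$, and let $\nu_{21}$ satisfy $\nu_{21}/E_2=\nu_{12}/E_1$. Put $$\mathcal K=\frac{E_2}{1-\nu_{12}\nu_{21}},\qquad \kappa=\frac{E_1-E_2}{E_2},\qquad E=(\kappa+1-\nu^2)\,\mathcal K .$$ For $\ell>0$ let $\Omega=\Omega_\ell=(0,L)\times(-\ell,\ell)$ and $I=d^3\ell/6$, and let $H^2_*(\Omega)=\{w\in H^2(\Omega): w=0 \text{ on } \{0,L\}\times(-\ell,\ell)\}$, where each element of $H^2(\Omega)$ is identified with its representative that is continuous on $\overline\Omega$. Let $f\in L^2(0,L)$, regarded also as the function $(x,y)\mapsto f(x)$ in $L^2(\Omega)$. For every $\ell>0$ there is a unique solution $u_\ell$ of the plate problem $$\begin{cases}\frac{d^3\mathcal K}{12}\left(\Delta^2u+\kappa\,\partial_x^4u\right)=f & \text{in }\Omega,\\ u=u_{xx}=0 & \text{on }\{0,L\}\times(-\ell,\ell),\\ u_{yy}+\nu u_{xx}=0,\quad u_{yyy}+(2-\nu)u_{xxy}=0 & \text{on }(0,L)\times\{\pm\ell\},\end{cases}$$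 understood in the weak sense: $u_\ell\in H^2_*(\Omega)$ and $$\frac{d^3\mathcal K}{12}\int_\Omega\left[\nu\,\Delta u_\ell\,\Delta v+(1-\nu)\,D^2u_\ell:D^2v+\kappa\,(u_\ell)_{xx}v_{xx}\right]dx\,dy=\int_\Omega f v\,dx\,dy\qquad\text{for all }v\in H^2_*(\Omega).$$ There is also a function $\psi$ on $[0,L]$, independent of $\ell$, which for every $\ell>0$ is the unique solution of the hinged beam problem $$EI\,\psi''''=2\ell f\ \text{ a.e. in }(0,L),\qquad \psi(0)=\psi(L)=\psi''(0)=\psi''(L)=0,$$ among the functions $\psi\in C^3([0,L])$ with $\psi'''$ absolutely continuous. Moreover $$\sup_{(x,y)\in\Omega_\ell}|u_\ell(x,y)-\psi(x)|\to0\qquad\text{as }\ell\to0^+ .$$ -/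

import Mathlib

open MeasureTheory Set Filter Topology
open scoped ContDiff ENNReal

namespace OrthotropicPlate

noncomputable section

/-! ### Weak derivatives and the Sobolev space of order two in the plane -/

/-- Classical partial derivative in the first variable. -/
def partialX (φ : ℝ × ℝ → ℝ) (p : ℝ × ℝ) : ℝ := fderiv ℝ φ p (1, 0)

/-- Classical partial derivative in the second variable. -/
def partialY (φ : ℝ × ℝ → ℝ) (p : ℝ × ℝ) : ℝ := fderiv ℝ φ p (0, 1)

/-- `φ` is a test function on `Ω`: smooth, with compact support contained in `Ω`. -/
structure IsTestFunction (Ω : Set (ℝ × ℝ)) (φ : ℝ × ℝ → ℝ) : Prop where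
  smooth : ContDiff ℝ ∞ φ
  compact : HasCompactSupport φ
  support_subset : tsupport φ ⊆ Ω

/-- `g` is the weak derivative `∂ₓ^i ∂_y^j u` of `u` in `Ω`. -/
def HasWeakDeriv (Ω : Set (ℝ × ℝ)) (i j : ℕ) (u g : ℝ × ℝ → ℝ) : Prop :=
  ∀ φ : ℝ × ℝ → ℝ, IsTestFunction Ω φ →
    ∫ p in Ω, u p * (partialX^[i] (partialY^[j] φ)) p = (-1) ^ (i + j) * ∫ p in Ω, g p * φ p

/-- `g` is a weak derivative `∂ₓ^i ∂_y^j u` of `u` in `Ω` that belongs to `L²(Ω)`. -/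
def IsL2WeakDeriv (Ω : Set (ℝ × ℝ)) (i j : ℕ) (u g : ℝ × ℝ → ℝ) : Prop :=
  MemLp g 2 (volume.restrict Ω) ∧ HasWeakDeriv Ω i j u g

/-- `u ∈ H²(Ω)`: `u` and all its weak derivatives of order at most two are in `L²(Ω)`. -/
def MemH2 (Ω : Set (ℝ × ℝ)) (u : ℝ × ℝ → ℝ) : Prop :=
  MemLp u 2 (volume.restrict Ω) ∧
    ∀ i j : ℕ, i + j ≤ 2 → ∃ g : ℝ × ℝ → ℝ, IsL2WeakDeriv Ω i j u g

open Classical in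
/-- The weak derivative `∂ₓ^i ∂_y^j u` in `L²(Ω)`, determined up to null sets
(zero where there is none). -/
def weakDeriv (Ω : Set (ℝ × ℝ)) (i j : ℕ) (u : ℝ × ℝ → ℝ) : ℝ × ℝ → ℝ :=
  if h : ∃ g : ℝ × ℝ → ℝ, IsL2WeakDeriv Ω i j u g then h.choose else 0

/-! ### The plate -/

/-- The midway surface `Ω = (0, L) × (-ℓ, ℓ)` of the plate. -/
def plate (L ℓ : ℝ) : Set (ℝ × ℝ) := Ioo 0 L ×ˢ Ioo (-ℓ) ℓ

/-- The closed rectangle `[0, L] × [-ℓ, ℓ]`. -/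
def closedPlate (L ℓ : ℝ) : Set (ℝ × ℝ) := Icc 0 L ×ˢ Icc (-ℓ) ℓ

/-- `u ∈ H²_*(Ω)`: `u ∈ H²(Ω)` and `u = 0` on `{0, L} × (-ℓ, ℓ)`. As `H²(Ω) ⊆ C⁰(closure of Ω)` in
the plane, every element of `H²(Ω)` is taken to be its continuous representative, for which the
boundary condition is meant pointwise. Values off the closed rectangle are irrelevant. -/
structure MemH2Star (L ℓ : ℝ) (u : ℝ × ℝ → ℝ) : Prop where
  memH2 : MemH2 (plate L ℓ) u
  continuousOn : ContinuousOn u (closedPlate L ℓ)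
  left : ∀ y ∈ Ioo (-ℓ) ℓ, u (0, y) = 0
  right : ∀ y ∈ Ioo (-ℓ) ℓ, u (L, y) = 0

/-- The scalar product
`(u, v)_{H²_*} = ∫_Ω [ν Δu Δv + (1 - ν) D²u : D²v + κ u_xx v_xx]`. -/
def innerH2Star (Ω : Set (ℝ × ℝ)) (ν κ : ℝ) (u v : ℝ × ℝ → ℝ) : ℝ :=
  ∫ p in Ω,
    (ν * ((weakDeriv Ω 2 0 u p + weakDeriv Ω 0 2 u p) *
          (weakDeriv Ω 2 0 v p + weakDeriv Ω 0 2 v p))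
      + (1 - ν) * (weakDeriv Ω 2 0 u p * weakDeriv Ω 2 0 v p
          + 2 * (weakDeriv Ω 1 1 u p * weakDeriv Ω 1 1 v p)
          + weakDeriv Ω 0 2 u p * weakDeriv Ω 0 2 v p)
      + κ * (weakDeriv Ω 2 0 u p * weakDeriv Ω 2 0 v p))

/-- `u` is the (weak) solution, in `H²_*(Ω)`, of the boundary value problem
`(d³ K / 12) (Δ² u + κ ∂ₓ⁴ u) = f` in `Ω = (0, L) × (-ℓ, ℓ)`,
`u = u_xx = 0` on the edges `x = 0, L`,
`u_yy + ν u_xx = 0` and `u_yyy + (2 - ν) u_xxy = 0` on the edges `y = ±ℓ`. -/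
structure IsPlateSolution (L ℓ d K κ ν : ℝ) (f u : ℝ × ℝ → ℝ) : Prop where
  mem : MemH2Star L ℓ u
  variational : ∀ v : ℝ × ℝ → ℝ, MemH2Star L ℓ v →
    d ^ 3 * K / 12 * innerH2Star (plate L ℓ) ν κ u v = ∫ p in plate L ℓ, f p * v p

/-! ### Elastic coefficients -/

/-- `K = E₂ / (1 - ν₁₂ ν₂₁)`. -/
def coeffK (E₂ ν₁₂ ν₂₁ : ℝ) : ℝ := E₂ / (1 - ν₁₂ * ν₂₁)

/-- `κ = (E₁ - E₂) / E₂`. -/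
def coeffKappa (E₁ E₂ : ℝ) : ℝ := (E₁ - E₂) / E₂

/-! ### The beam -/

/-- The moment of inertia `I = ∫ z² dy dz = d³ ℓ / 6` of the cross section
`(-ℓ, ℓ) × (-d/2, d/2)`. -/
def momentOfInertia (d ℓ : ℝ) : ℝ := d ^ 3 * ℓ / 6

/-- `ψ` solves the hinged beam problem `B ψ'''' = q` in `(0, L)`,
`ψ(0) = ψ(L) = ψ''(0) = ψ''(L) = 0`: it is of class `C³` on `[0, L]` with `ψ'''` absolutely
continuous, and satisfies the equation almost everywhere. -/
structure IsHingedBeamSolution (L B : ℝ) (q ψ : ℝ → ℝ) : Prop where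
  contDiffOn : ContDiffOn ℝ 3 ψ (Icc 0 L)
  absolutelyContinuous :
    AbsolutelyContinuousOnInterval (iteratedDerivWithin 3 ψ (Icc 0 L)) 0 L
  equation : ∀ᵐ x ∂(volume.restrict (Ioo 0 L)), B * iteratedDerivWithin 4 ψ (Icc 0 L) x = q x
  left : ψ 0 = 0
  right : ψ L = 0
  left_two : iteratedDerivWithin 2 ψ (Icc 0 L) 0 = 0
  right_two : iteratedDerivWithin 2 ψ (Icc 0 L) L = 0

end

end OrthotropicPlate

namespace OrthotropicPlate

/-! ### Test functions -/

/-! The convergence is an energy estimate around an ansatz. The beam deflection `ψ` alone is not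
nearly a plate solution, because a plate bent along `x` also curves across its width: the free edges
ask for `u_yy = -ν u_xx`. The corrected profile `U = ψ - (ν/2) y² ψ''` has this transverse
curvature. Its second derivatives are `(ψ'', 0, -ν ψ'')` up to terms `y² ψ''''` and `y ψ'''`. For
the leading triple the energy density against `v` collapses to `(κ + 1 - ν²) ψ'' v_xx`: the `v_yy`
terms cancel, and the factor is the one that defines `E`. Integrating twice by parts in `x` turns `∫
ψ'' v_xx` into `∫ ψ'''' v`, so `U` satisfies the variational equation up to a remainder that is
small in `y` (`IsBeamProfile.integral_mul_xx`, `plateDensity_corrector_le`).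

Testing with `W = u - U` and absorbing by Young's inequality bounds `‖W_xx‖² + ‖W_xy‖²` in `L²` by a
constant times `ℓ³`: `ℓ²` from the remainder and one `ℓ` from the width of the plate. The embedding
into bounded functions degenerates on thin plates, but only like `sup |W|² ≤ C ℓ⁻¹ (‖W_xx‖² +
‖W_xy‖²)` (`IsJet.sq_apply_le`). Hence `W = O(ℓ)` uniformly; as `U - ψ = O(ℓ)` too, the rate is
linear in `ℓ`.

The embedding is proved on slices. A weak derivative in `x` makes a function a primitive on almost
every horizontal line; exchanging the variables gives the same for `y`. As `u` vanishes at both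
ends, `u_x` has mean zero on almost every horizontal line and is controlled by `u_xx`; `u_xy` then
controls its variation across the width, and integrating in `x` bounds `u`.

Existence is Lax–Milgram on the space of tuples `(u, u_x, u_y, u_xx, u_xy, u_yy)` inside a product
of `L²` spaces. The sup bound makes this subspace closed, since limits keep a continuous
representative and the boundary values; the slice estimates make the form coercive. Uniqueness holds
because zero energy forces `u = 0` by the same sup bound. The beam problem is solved by explicit
integration, and its uniqueness by integrating the difference back from the third derivative. -/

theorem IsTestFunction.partialX {Ω : Set (ℝ × ℝ)} {φ : ℝ × ℝ → ℝ} (h : IsTestFunction Ω φ) :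
    IsTestFunction Ω (partialX φ) where
  smooth := (h.smooth.fderiv_right (m := ∞) (by simp)).clm_apply contDiff_const
  compact := h.compact.fderiv_apply ℝ (1, 0)
  support_subset := (tsupport_fderiv_apply_subset ℝ _).trans h.support_subset

theorem IsTestFunction.partialY {Ω : Set (ℝ × ℝ)} {φ : ℝ × ℝ → ℝ} (h : IsTestFunction Ω φ) :
    IsTestFunction Ω (partialY φ) where
  smooth := (h.smooth.fderiv_right (m := ∞) (by simp)).clm_apply contDiff_const
  compact := h.compact.fderiv_apply ℝ (0, 1)
  support_subset := (tsupport_fderiv_apply_subset ℝ _).trans h.support_subset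

theorem IsTestFunction.iterate_partialX {Ω : Set (ℝ × ℝ)} {φ : ℝ × ℝ → ℝ}
    (h : IsTestFunction Ω φ) (n : ℕ) :
    IsTestFunction Ω (OrthotropicPlate.partialX^[n] φ) := by
  induction n with
  | zero => exact h
  | succ n ih => rw [Function.iterate_succ_apply']; exact ih.partialX

theorem IsTestFunction.iterate_partialY {Ω : Set (ℝ × ℝ)} {φ : ℝ × ℝ → ℝ}
    (h : IsTestFunction Ω φ) (n : ℕ) :
    IsTestFunction Ω (OrthotropicPlate.partialY^[n] φ) := by
  induction n with
  | zero => exact h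
  | succ n ih => rw [Function.iterate_succ_apply']; exact ih.partialY

theorem partialX_partialY {φ : ℝ × ℝ → ℝ} (h : ContDiff ℝ ∞ φ) :
    partialX (partialY φ) = partialY (partialX φ) := by
  funext p
  have hd : DifferentiableAt ℝ (fderiv ℝ φ) p :=
    ((h.fderiv_right (m := 1) (by norm_cast)).differentiable one_ne_zero) p
  have hs : IsSymmSndFDerivAt ℝ φ p :=
    h.contDiffAt.isSymmSndFDerivAt (by simp; norm_cast)
  unfold partialX partialY
  rw [fderiv_clm_apply hd (differentiableAt_const _),
    fderiv_clm_apply hd (differentiableAt_const _)]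
  simpa using hs.eq (1, 0) (0, 1)

theorem IsTestFunction.partialX_iterate_partialY {Ω : Set (ℝ × ℝ)} {φ : ℝ × ℝ → ℝ}
    (h : IsTestFunction Ω φ) (n : ℕ) :
    OrthotropicPlate.partialX (OrthotropicPlate.partialY^[n] φ) =
      OrthotropicPlate.partialY^[n] (OrthotropicPlate.partialX φ) := by
  induction n with
  | zero => rfl
  | succ n ih =>
    rw [Function.iterate_succ_apply', Function.iterate_succ_apply',
      partialX_partialY (h.iterate_partialY n).smooth, ih]

theorem IsTestFunction.iterate_partialX_iterate_partialY {Ω : Set (ℝ × ℝ)} {φ : ℝ × ℝ → ℝ}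
    (h : IsTestFunction Ω φ) (m n : ℕ) :
    OrthotropicPlate.partialX^[m] (OrthotropicPlate.partialY^[n] φ) =
      OrthotropicPlate.partialY^[n] (OrthotropicPlate.partialX^[m] φ) := by
  induction m with
  | zero => rfl
  | succ m ih =>
    rw [Function.iterate_succ_apply', Function.iterate_succ_apply', ih,
      (h.iterate_partialX m).partialX_iterate_partialY]

theorem IsTestFunction.iterate_add {Ω : Set (ℝ × ℝ)} {φ : ℝ × ℝ → ℝ}
    (h : IsTestFunction Ω φ) (i j k m : ℕ) :
    OrthotropicPlate.partialX^[i + k] (OrthotropicPlate.partialY^[j + m] φ) =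
      OrthotropicPlate.partialX^[i] (OrthotropicPlate.partialY^[j]
        (OrthotropicPlate.partialX^[k] (OrthotropicPlate.partialY^[m] φ))) := by
  rw [Function.iterate_add_apply, Function.iterate_add_apply,
    ((h.iterate_partialY m).iterate_partialX_iterate_partialY k j)]

theorem IsTestFunction.integrable_mul {Ω : Set (ℝ × ℝ)} {φ g : ℝ × ℝ → ℝ}
    {μ : Measure (ℝ × ℝ)} (h : IsTestFunction Ω φ) (hg : Integrable g μ) :
    Integrable (fun p => g p * φ p) μ := by
  obtain ⟨C, hC⟩ := h.compact.exists_bound_of_continuous h.smooth.continuous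
  exact hg.mul_bdd h.smooth.continuous.aestronglyMeasurable (ae_of_all _ hC)

theorem IsTestFunction.setIntegral_mul {Ω : Set (ℝ × ℝ)} {φ g : ℝ × ℝ → ℝ}
    (h : IsTestFunction Ω φ) : ∫ p in Ω, g p * φ p = ∫ p, g p * φ p := by
  apply setIntegral_eq_integral_of_forall_compl_eq_zero
  intro p hp
  have : φ p = 0 := image_eq_zero_of_notMem_tsupport fun hmem => hp (h.support_subset hmem)
  simp [this]

/-! ### Weak derivatives -/

section HasWeakDeriv

variable {Ω : Set (ℝ × ℝ)} {i j k m : ℕ} {u v g h : ℝ × ℝ → ℝ}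

theorem HasWeakDeriv.congr (hg : HasWeakDeriv Ω i j u g) (huv : u =ᵐ[volume.restrict Ω] v)
    (hgh : g =ᵐ[volume.restrict Ω] h) : HasWeakDeriv Ω i j v h := by
  intro φ hφ
  have h1 : ∫ p in Ω, v p * (OrthotropicPlate.partialX^[i] (OrthotropicPlate.partialY^[j] φ)) p =
      ∫ p in Ω, u p * (OrthotropicPlate.partialX^[i] (OrthotropicPlate.partialY^[j] φ)) p := by
    apply integral_congr_ae
    filter_upwards [huv] with p hp
    rw [hp]
  have h2 : ∫ p in Ω, h p * φ p = ∫ p in Ω, g p * φ p := by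
    apply integral_congr_ae
    filter_upwards [hgh] with p hp
    rw [hp]
  rw [h1, h2, hg φ hφ]

theorem HasWeakDeriv.trans (hg : HasWeakDeriv Ω i j u g) (hh : HasWeakDeriv Ω k m g h) :
    HasWeakDeriv Ω (i + k) (j + m) u h := by
  intro φ hφ
  rw [hφ.iterate_add, hg _ ((hφ.iterate_partialY m).iterate_partialX k), hh φ hφ]
  ring

/-- Derivatives of test functions are test functions, so the identity for the higher derivative can
be read as one for `g`. This is how `u_xx` and `u_xy` become first derivatives of `u_x`, although
only `u` is differentiated in the definition of `H²`. -/
theorem HasWeakDeriv.of_trans (hg : HasWeakDeriv Ω i j u g)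
    (hh : HasWeakDeriv Ω (i + k) (j + m) u h) : HasWeakDeriv Ω k m g h := by
  intro φ hφ
  have h1 := hh φ hφ
  rw [hφ.iterate_add, hg _ ((hφ.iterate_partialY m).iterate_partialX k)] at h1
  have h2 : ((-1 : ℝ) ^ (i + j)) * (-1) ^ (i + j) = 1 := by rw [← mul_pow]; simp
  have h3 : (-1 : ℝ) ^ (i + k + (j + m)) = (-1) ^ (i + j) * (-1) ^ (k + m) := by ring
  rw [h3, mul_assoc] at h1
  exact mul_left_cancel₀ (left_ne_zero_of_mul_eq_one h2) h1

theorem HasWeakDeriv.add {g' : ℝ × ℝ → ℝ} (hg : HasWeakDeriv Ω i j u g)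
    (hg' : HasWeakDeriv Ω i j v g')
    (hu : IntegrableOn u Ω) (hv : IntegrableOn v Ω) (ig : IntegrableOn g Ω)
    (ig' : IntegrableOn g' Ω) :
    HasWeakDeriv Ω i j (fun p => u p + v p) (fun p => g p + g' p) := by
  intro φ hφ
  have ht := (hφ.iterate_partialY j).iterate_partialX i
  simp only [add_mul]
  rw [integral_add (ht.integrable_mul hu) (ht.integrable_mul hv),
    integral_add (hφ.integrable_mul ig) (hφ.integrable_mul ig'), hg φ hφ, hg' φ hφ, mul_add]

theorem HasWeakDeriv.const_mul (hg : HasWeakDeriv Ω i j u g) (r : ℝ) :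
    HasWeakDeriv Ω i j (fun p => r * u p) (fun p => r * g p) := by
  intro φ hφ
  simp only [mul_assoc, integral_const_mul]
  rw [hg φ hφ]
  ring

theorem hasWeakDeriv_zero_zero : HasWeakDeriv Ω 0 0 u u := by
  intro φ _
  simp

theorem HasWeakDeriv.ae_eq (hΩ : IsOpen Ω) (hg : HasWeakDeriv Ω i j u g)
    (hh : HasWeakDeriv Ω i j u h) (ig : IntegrableOn g Ω) (ih : IntegrableOn h Ω) :
    g =ᵐ[volume.restrict Ω] h := by
  have key : ∀ᵐ p, p ∈ Ω → (g - h) p = 0 := by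
    apply hΩ.ae_eq_zero_of_integral_contDiff_smul_eq_zero
    · exact (ig.sub ih).locallyIntegrableOn
    intro φ h1 h2 h3
    have hφ : IsTestFunction Ω φ := ⟨h1, h2, h3⟩
    have e : ∫ p in Ω, g p * φ p = ∫ p in Ω, h p * φ p := by
      have := (hg φ hφ).symm.trans (hh φ hφ)
      exact mul_left_cancel₀ (pow_ne_zero _ (by norm_num)) this
    calc ∫ p, φ p • (g - h) p = ∫ p, (g - h) p * φ p := by simp [mul_comm]
      _ = ∫ p in Ω, (g - h) p * φ p := hφ.setIntegral_mul.symm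
      _ = ∫ p in Ω, (g p * φ p - h p * φ p) := by simp [sub_mul]
      _ = 0 := by rw [integral_sub (hφ.integrable_mul ig) (hφ.integrable_mul ih), e, sub_self]
  rw [EventuallyEq, ae_restrict_iff' hΩ.measurableSet]
  filter_upwards [key] with p hp hpΩ
  exact sub_eq_zero.mp (hp hpΩ)

end HasWeakDeriv

/-! ### Exchanging the variables -/

theorem partialX_comp_swap {φ : ℝ × ℝ → ℝ} (h : ContDiff ℝ ∞ φ) (p : ℝ × ℝ) :
    partialX (φ ∘ Prod.swap) p = partialY φ p.swap := by
  have hd : DifferentiableAt ℝ φ p.swap := h.differentiable (by simp) _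
  have hs : HasFDerivAt (Prod.swap : ℝ × ℝ → ℝ × ℝ)
      (ContinuousLinearEquiv.prodComm ℝ ℝ ℝ : ℝ × ℝ →L[ℝ] ℝ × ℝ) p :=
    (ContinuousLinearEquiv.prodComm ℝ ℝ ℝ).hasFDerivAt
  unfold partialX partialY
  rw [(hd.hasFDerivAt.comp p hs).fderiv]
  simp

theorem IsTestFunction.comp_swap {s t : Set ℝ} {φ : ℝ × ℝ → ℝ} (h : IsTestFunction (s ×ˢ t) φ) :
    IsTestFunction (t ×ˢ s) (φ ∘ Prod.swap) where
  smooth := h.smooth.comp (contDiff_snd.prodMk contDiff_fst)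
  compact := h.compact.comp_homeomorph (Homeomorph.prodComm ℝ ℝ)
  support_subset := by
    intro p hp
    have h1 : p ∈ Prod.swap ⁻¹' tsupport φ :=
      tsupport_comp_subset_preimage φ continuous_swap hp
    have h2 := h.support_subset h1
    exact ⟨h2.2, h2.1⟩

theorem setIntegral_prod_swap_eq (s t : Set ℝ) (F : ℝ × ℝ → ℝ) :
    ∫ p in t ×ˢ s, F p.swap = ∫ p in s ×ˢ t, F p := by
  simp only [Measure.volume_eq_prod]
  exact setIntegral_prod_swap s t F

theorem integrableOn_comp_swap {s t : Set ℝ} {u : ℝ × ℝ → ℝ} (h : IntegrableOn u (s ×ˢ t)) :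
    IntegrableOn (u ∘ Prod.swap) (t ×ˢ s) := by
  rw [IntegrableOn, Measure.volume_eq_prod, ← Measure.prod_restrict] at *
  exact h.swap

/-- Lets the slice results, proved in the first variable only, be applied in the second. -/
theorem HasWeakDeriv.comp_swap {s t : Set ℝ} {u g : ℝ × ℝ → ℝ}
    (h : HasWeakDeriv (s ×ˢ t) 0 1 u g) :
    HasWeakDeriv (t ×ˢ s) 1 0 (u ∘ Prod.swap) (g ∘ Prod.swap) := by
  intro φ hφ
  have h1 := h _ hφ.comp_swap
  rw [← setIntegral_prod_swap_eq, ← setIntegral_prod_swap_eq s t (fun p => g p * _)] at h1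
  have h2 : ∀ p : ℝ × ℝ, partialY (φ ∘ Prod.swap) p.swap = partialX φ p := by
    intro p
    rw [← partialX_comp_swap hφ.comp_swap.smooth]
    rfl
  simpa [h2] using h1

theorem HasWeakDeriv.comp_swap' {s t : Set ℝ} {u g : ℝ × ℝ → ℝ}
    (h : HasWeakDeriv (s ×ˢ t) 1 0 u g) :
    HasWeakDeriv (t ×ˢ s) 0 1 (u ∘ Prod.swap) (g ∘ Prod.swap) := by
  intro φ hφ
  have h1 := h _ hφ.comp_swap
  rw [← setIntegral_prod_swap_eq, ← setIntegral_prod_swap_eq s t (fun p => g p * _)] at h1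
  simpa [partialX_comp_swap hφ.smooth] using h1

/-! ### Integration by parts for primitives of integrable functions -/

theorem absolutelyContinuousOnInterval_primitive {a b : ℝ} {p : ℝ → ℝ} (α : ℝ)
    (hp : IntervalIntegrable p volume a b) :
    AbsolutelyContinuousOnInterval (fun x => α + ∫ s in a..x, p s) a b := by
  have hc : AbsolutelyContinuousOnInterval (fun _ : ℝ => α) a b :=
    (LipschitzWith.const α).lipschitzOnWith.absolutelyContinuousOnInterval
  exact hc.add (hp.absolutelyContinuousOnInterval_intervalIntegral (c := a) left_mem_uIcc)

theorem ae_deriv_primitive {a b : ℝ} {p : ℝ → ℝ} (α : ℝ) (hp : IntervalIntegrable p volume a b) :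
    ∀ᵐ x, x ∈ uIoc a b → deriv (fun x => α + ∫ s in a..x, p s) x = p x := by
  filter_upwards [hp.ae_hasDerivAt_integral] with x hx hmem
  exact ((hx (uIoc_subset_uIcc hmem) a left_mem_uIcc).const_add α).deriv

/-- Primitives of integrable functions are absolutely continuous, with the expected derivative
almost everywhere; no continuity of `p` or `q` is needed, as suits slices of `L²` functions. -/
theorem integral_primitive_mul_primitive {a b : ℝ} {p q : ℝ → ℝ} (α β : ℝ)
    (hp : IntervalIntegrable p volume a b) (hq : IntervalIntegrable q volume a b) :
    ∫ x in a..b, (α + ∫ s in a..x, p s) * q x =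
      (α + ∫ s in a..b, p s) * (β + ∫ s in a..b, q s) - α * β -
        ∫ x in a..b, p x * (β + ∫ s in a..x, q s) := by
  have h := (absolutelyContinuousOnInterval_primitive α hp).integral_mul_deriv_eq_deriv_mul
    (absolutelyContinuousOnInterval_primitive β hq)
  have h1 : ∫ x in a..b, (α + ∫ s in a..x, p s) * deriv (fun x => β + ∫ s in a..x, q s) x =
      ∫ x in a..b, (α + ∫ s in a..x, p s) * q x := by
    apply intervalIntegral.integral_congr_ae
    filter_upwards [ae_deriv_primitive β hq] with x hx hmem
    rw [hx hmem]
  have h2 : ∫ x in a..b, deriv (fun x => α + ∫ s in a..x, p s) x * (β + ∫ s in a..x, q s) =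
      ∫ x in a..b, p x * (β + ∫ s in a..x, q s) := by
    apply intervalIntegral.integral_congr_ae
    filter_upwards [ae_deriv_primitive α hp] with x hx hmem
    rw [hx hmem]
  rw [← h1, h, h2]
  simp

/-- Integration by parts of a primitive against a smooth function vanishing at the end points. -/
theorem integral_primitive_mul_deriv {a b : ℝ} {p φ : ℝ → ℝ} (α : ℝ)
    (hp : IntervalIntegrable p volume a b) (hφ : ContDiff ℝ 1 φ) (ha : φ a = 0) (hb : φ b = 0) :
    ∫ x in a..b, (α + ∫ s in a..x, p s) * deriv φ x = -∫ x in a..b, p x * φ x := by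
  have hc : Continuous (deriv φ) := hφ.continuous_deriv le_rfl
  have hφ' : ∀ x, φ x = 0 + ∫ s in a..x, deriv φ s := by
    intro x
    rw [intervalIntegral.integral_deriv_eq_sub
      (fun y _ => (hφ.differentiable one_ne_zero) y) (hc.intervalIntegrable _ _), ha]
    ring
  rw [integral_primitive_mul_primitive α 0 hp (hc.intervalIntegrable a b)]
  simp only [← hφ', hb]
  simp

/-! ### Integrals over open intervals -/

theorem intervalIntegral_eq_setIntegral_Ioo {a b : ℝ} (hab : a ≤ b) (p : ℝ → ℝ) :
    ∫ x in a..b, p x = ∫ x in Ioo a b, p x := by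
  rw [intervalIntegral.integral_of_le hab, integral_Ioc_eq_integral_Ioo]

theorem intervalIntegrable_iff_Ioo {a b : ℝ} (hab : a ≤ b) {p : ℝ → ℝ} :
    IntervalIntegrable p volume a b ↔ IntegrableOn p (Ioo a b) :=
  intervalIntegrable_iff_integrableOn_Ioo_of_le hab

theorem abs_intervalIntegral_le {a b x y : ℝ} {p : ℝ → ℝ}
    (hp : IntegrableOn p (Ioo a b)) (hx : x ∈ Icc a b) (hy : y ∈ Icc a b) :
    |∫ s in x..y, p s| ≤ ∫ s in Ioo a b, |p s| := by
  have h1 : |∫ s in x..y, p s| ≤ ∫ s in uIoc x y, |p s| := by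
    simpa using intervalIntegral.norm_integral_le_integral_norm_uIoc (f := p) (a := x) (b := y)
  refine h1.trans ?_
  rw [← integral_Ioc_eq_integral_Ioo]
  apply setIntegral_mono_set
  · exact ((integrableOn_Ioc_iff_integrableOn_Ioo (by simp)).mpr hp).abs
  · exact ae_of_all _ fun _ => abs_nonneg _
  · apply LE.le.eventuallyLE
    intro z hz
    rcases le_total x y with h | h
    · rw [uIoc_of_le h] at hz; exact ⟨hx.1.trans_lt hz.1, hz.2.trans hy.2⟩
    · rw [uIoc_of_ge h] at hz; exact ⟨hy.1.trans_lt hz.1, hz.2.trans hx.2⟩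

theorem continuousOn_primitive_Icc {a b : ℝ} (hab : a ≤ b) {p : ℝ → ℝ}
    (hp : IntegrableOn p (Ioo a b)) :
    ContinuousOn (fun x => ∫ s in a..x, p s) (Icc a b) := by
  rw [← uIcc_of_le hab]
  exact intervalIntegral.continuousOn_primitive_interval'
    ((intervalIntegrable_iff_Ioo hab).mpr hp) left_mem_uIcc

/-! ### Test functions on an interval -/

/-- `φ` is a test function on the subset `s` of the line. -/
structure IsTestFunction₁ (s : Set ℝ) (φ : ℝ → ℝ) : Prop where
  smooth : ContDiff ℝ ∞ φ
  compact : HasCompactSupport φ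
  support_subset : tsupport φ ⊆ s

namespace IsTestFunction₁

variable {s t : Set ℝ} {φ η : ℝ → ℝ}

theorem eq_zero (h : IsTestFunction₁ s φ) {x : ℝ} (hx : x ∉ s) : φ x = 0 :=
  image_eq_zero_of_notMem_tsupport fun hmem => hx (h.support_subset hmem)

theorem integrable_mul (h : IsTestFunction₁ s φ) {g : ℝ → ℝ} {μ : Measure ℝ}
    (hg : Integrable g μ) : Integrable (fun x => g x * φ x) μ := by
  obtain ⟨C, hC⟩ := h.compact.exists_bound_of_continuous h.smooth.continuous
  exact hg.mul_bdd h.smooth.continuous.aestronglyMeasurable (ae_of_all _ hC)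

theorem setIntegral_mul (h : IsTestFunction₁ s φ) (g : ℝ → ℝ) :
    ∫ x in s, g x * φ x = ∫ x, g x * φ x := by
  apply setIntegral_eq_integral_of_forall_compl_eq_zero
  intro p hp
  simp [h.eq_zero hp]

theorem prod (hφ : IsTestFunction₁ s φ) (hη : IsTestFunction₁ t η) :
    IsTestFunction (s ×ˢ t) (fun p => φ p.1 * η p.2) := by
  have hsub : tsupport (fun p : ℝ × ℝ => φ p.1 * η p.2) ⊆ tsupport φ ×ˢ tsupport η := by
    apply closure_minimal _ ((isClosed_tsupport φ).prod (isClosed_tsupport η))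
    intro p hp
    have hp' : φ p.1 * η p.2 ≠ 0 := hp
    exact ⟨subset_tsupport _ (left_ne_zero_of_mul hp'),
      subset_tsupport _ (right_ne_zero_of_mul hp')⟩
  refine ⟨(hφ.smooth.comp contDiff_fst).mul (hη.smooth.comp contDiff_snd), ?_,
    hsub.trans (prod_mono hφ.support_subset hη.support_subset)⟩
  exact (hφ.compact.isCompact.prod hη.compact.isCompact).of_isClosed_subset
    (isClosed_tsupport _) hsub

end IsTestFunction₁

theorem partialX_mul {φ η : ℝ → ℝ} (hφ : ContDiff ℝ ∞ φ) (hη : ContDiff ℝ ∞ η) (p : ℝ × ℝ) :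
    partialX (fun p => φ p.1 * η p.2) p = deriv φ p.1 * η p.2 := by
  have h1 : HasFDerivAt (fun p : ℝ × ℝ => φ p.1) _ p :=
    ((hφ.differentiable (by simp)) p.1).hasDerivAt.comp_hasFDerivAt p (hasFDerivAt_fst (𝕜 := ℝ) (p := p))
  have h2 : HasFDerivAt (fun p : ℝ × ℝ => η p.2) _ p :=
    ((hη.differentiable (by simp)) p.2).hasDerivAt.comp_hasFDerivAt p (hasFDerivAt_snd (𝕜 := ℝ) (p := p))
  unfold partialX
  rw [(h1.fun_mul h2).fderiv]
  simp [mul_comm]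

/-- The fundamental lemma of the calculus of variations. -/
theorem ae_eq_zero_of_integral_mul_test {s : Set ℝ} (hs : IsOpen s) {G : ℝ → ℝ}
    (hG : IntegrableOn G s) (h : ∀ η, IsTestFunction₁ s η → ∫ x in s, G x * η x = 0) :
    G =ᵐ[volume.restrict s] 0 := by
  have key : ∀ᵐ p, p ∈ s → G p = 0 := by
    apply hs.ae_eq_zero_of_integral_contDiff_smul_eq_zero hG.locallyIntegrableOn
    intro φ h1 h2 h3
    have hφ : IsTestFunction₁ s φ := ⟨h1, h2, h3⟩
    rw [← h φ hφ, hφ.setIntegral_mul]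
    simp [mul_comm]
  rwa [EventuallyEq, ae_restrict_iff' hs.measurableSet]

theorem exists_Icc_superset_of_isCompact {a b : ℝ} (hab : a < b) {K : Set ℝ} (hK : IsCompact K)
    (hKab : K ⊆ Ioo a b) : ∃ a' b', a < a' ∧ a' ≤ b' ∧ b' < b ∧ K ⊆ Icc a' b' := by
  rcases K.eq_empty_or_nonempty with rfl | hne
  · exact ⟨(a + b) / 2, (a + b) / 2, by linarith, le_rfl, by linarith, empty_subset _⟩
  · obtain ⟨x, hx⟩ := hK.exists_isLeast hne
    obtain ⟨y, hy⟩ := hK.exists_isGreatest hne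
    exact ⟨x, y, (hKab hx.1).1, hx.2 hy.1, (hKab hy.1).2, fun z hz => ⟨hx.2 hz, hy.2 hz⟩⟩

/-- A test function with mean zero is the derivative of a test function. -/
theorem IsTestFunction₁.exists_primitive {a b : ℝ} (hab : a < b) {θ : ℝ → ℝ}
    (hθ : IsTestFunction₁ (Ioo a b) θ) (h0 : ∫ x in Ioo a b, θ x = 0) :
    ∃ Φ, IsTestFunction₁ (Ioo a b) Φ ∧ deriv Φ = θ := by
  have hc : Continuous θ := hθ.smooth.continuous
  have hderiv : ∀ x, HasDerivAt (fun x => ∫ s in a..x, θ s) (θ x) x := fun x =>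
    intervalIntegral.integral_hasDerivAt_right (hc.intervalIntegrable _ _)
      (hc.stronglyMeasurableAtFilter _ _) hc.continuousAt
  have hde : deriv (fun x => ∫ s in a..x, θ s) = θ := funext fun x => (hderiv x).deriv
  obtain ⟨a', b', h1, h2, h3, h4⟩ :=
    exists_Icc_superset_of_isCompact hab hθ.compact.isCompact hθ.support_subset
  have hz : ∀ x ∉ Icc a' b', θ x = 0 := fun x hx =>
    image_eq_zero_of_notMem_tsupport fun hmem => hx (h4 hmem)
  -- To the left of the support nothing has been integrated yet; to its right the whole mean, which
  -- is zero, has been.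
  have hz' : ∀ x ∉ Icc a' b', ∫ s in a..x, θ s = 0 := by
    intro x hx
    rcases lt_or_ge x a' with hxa | hxa
    · rw [intervalIntegral.integral_zero_ae]
      refine ae_of_all _ fun s hs => hz s fun hs' => ?_
      have : s ≤ max a x := hs.2
      exact absurd (this.trans_lt (max_lt h1 hxa)) (not_lt.mpr hs'.1)
    · have hxb : b' < x := by
        by_contra hcon
        exact hx ⟨hxa, not_lt.mp hcon⟩
      have e1 : ∫ s in a..b, θ s = 0 := by
        rw [intervalIntegral_eq_setIntegral_Ioo hab.le, h0]
      have e2 : ∫ s in x..b, θ s = 0 := by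
        rw [intervalIntegral.integral_zero_ae]
        refine ae_of_all _ fun s hs => hz s fun hs' => ?_
        have : min x b < s := hs.1
        exact absurd ((lt_min hxb h3).trans this) (not_lt.mpr hs'.2)
      rw [← intervalIntegral.integral_add_adjacent_intervals (b := x)
        (hc.intervalIntegrable _ _) (hc.intervalIntegrable _ _), e2, add_zero] at e1
      exact e1
  have hsub : tsupport (fun x => ∫ s in a..x, θ s) ⊆ Icc a' b' := by
    apply closure_minimal _ isClosed_Icc
    intro x hx
    by_contra hcon
    exact hx (hz' x hcon)
  refine ⟨fun x => ∫ s in a..x, θ s, ⟨?_, ?_, ?_⟩, hde⟩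
  · rw [contDiff_infty_iff_deriv]
    refine ⟨fun x => (hderiv x).differentiableAt, ?_⟩
    rw [hde]
    exact hθ.smooth
  · exact isCompact_Icc.of_isClosed_subset (isClosed_tsupport _) hsub
  · exact hsub.trans (Icc_subset_Ioo h1 h3)

theorem exists_isTestFunction₁_integral_eq_one {a b : ℝ} (hab : a < b) :
    ∃ ρ, IsTestFunction₁ (Ioo a b) ρ ∧ ∫ x in Ioo a b, ρ x = 1 := by
  let f : ContDiffBump ((a + b) / 2) := ⟨(b - a) / 8, (b - a) / 4, by linarith, by linarith⟩
  have hsub : tsupport (f.normed volume) ⊆ Ioo a b := by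
    rw [f.tsupport_normed_eq, Real.closedBall_eq_Icc]
    apply Icc_subset_Ioo <;> simp only [f] <;> linarith
  have ht : IsTestFunction₁ (Ioo a b) (f.normed volume) :=
    ⟨f.contDiff_normed, f.hasCompactSupport_normed, hsub⟩
  refine ⟨_, ht, ?_⟩
  have := ht.setIntegral_mul (fun _ => 1)
  simpa [f.integral_normed] using this

/-! ### Functions of two variables on a rectangle -/

theorem restrict_prod_eq (s t : Set ℝ) : (volume.restrict (s ×ˢ t) : Measure (ℝ × ℝ)) =
    (volume.restrict s).prod (volume.restrict t) := by
  rw [Measure.volume_eq_prod, Measure.prod_restrict]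

/-- Rectangles form a π-system generating the product σ-algebra, so the vanishing of integrals
extends from them to all measurable sets. -/
theorem ae_eq_zero_of_setIntegral_rectangle {s t : Set ℝ} {w : ℝ × ℝ → ℝ}
    (hw : IntegrableOn w (s ×ˢ t))
    (h : ∀ B A, MeasurableSet B → MeasurableSet A →
      ∫ p in B ×ˢ A, w p ∂(volume.restrict (s ×ˢ t)) = 0) :
    w =ᵐ[volume.restrict (s ×ˢ t)] 0 := by
  have hwi : Integrable w (volume.restrict (s ×ˢ t)) := hw
  have huniv : ∫ p, w p ∂(volume.restrict (s ×ˢ t)) = 0 := by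
    simpa using h univ univ MeasurableSet.univ MeasurableSet.univ
  refine hwi.ae_eq_zero_of_forall_setIntegral_eq_zero fun S hS _ => ?_
  clear * - hwi huniv h hS
  induction S, hS using MeasurableSpace.induction_on_inter generateFrom_prod.symm
    isPiSystem_prod with
  | empty => simp
  | basic S hS =>
    obtain ⟨B, hB, A, hA, rfl⟩ := hS
    exact h B A hB hA
  | compl S hS ih =>
    have := integral_add_compl hS hwi
    rwa [ih, huniv, zero_add] at this
  | iUnion F hd hF ih =>
    rw [integral_iUnion hF hd hwi.integrableOn]
    simp [ih]

/-- An integrable function on a rectangle that is orthogonal to all products of test functions of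
one variable is zero. -/
theorem ae_eq_zero_of_integral_mul_prod_test {s t : Set ℝ} (hs : IsOpen s) (ht : IsOpen t)
    {w : ℝ × ℝ → ℝ} (hw : IntegrableOn w (s ×ˢ t))
    (h : ∀ φ η, IsTestFunction₁ s φ → IsTestFunction₁ t η →
      ∫ p in s ×ˢ t, w p * (φ p.1 * η p.2) = 0) :
    w =ᵐ[volume.restrict (s ×ˢ t)] 0 := by
  have hwi : Integrable w ((volume.restrict s).prod (volume.restrict t)) := by
    rw [← restrict_prod_eq]; exact hw
  have hφi : ∀ φ, IsTestFunction₁ s φ → Integrable (fun p : ℝ × ℝ => w p * φ p.1)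
      ((volume.restrict s).prod (volume.restrict t)) := by
    intro φ hφ
    obtain ⟨C, hC⟩ := hφ.compact.exists_bound_of_continuous hφ.smooth.continuous
    exact hwi.mul_bdd (hφ.smooth.continuous.comp continuous_fst).aestronglyMeasurable
      (ae_of_all _ fun p => hC p.1)
  -- The exceptional null set of `y` depends on `φ`. Therefore the next step first integrates over a
  -- measurable set `A` of `y`, which forgets that null set, and only then varies `φ`.
  have step1 : ∀ φ, IsTestFunction₁ s φ →
      (fun y => ∫ x in s, w (x, y) * φ x) =ᵐ[volume.restrict t] 0 := by
    intro φ hφ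
    apply ae_eq_zero_of_integral_mul_test ht
    · exact (hφi φ hφ).integral_prod_right
    intro η hη
    rw [← h φ η hφ hη, restrict_prod_eq, integral_prod_symm]
    · apply integral_congr_ae (ae_of_all _ fun y => ?_)
      simp only [← mul_assoc]
      rw [integral_mul_const]
    · rw [← restrict_prod_eq]
      exact (hφ.prod hη).integrable_mul hw
  apply ae_eq_zero_of_setIntegral_rectangle hw
  intro B A hB hA
  have step2 : (fun x => ∫ y in A, w (x, y) ∂(volume.restrict t)) =ᵐ[volume.restrict s] 0 := by
    have hwA : Integrable w ((volume.restrict s).prod ((volume.restrict t).restrict A)) :=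
      hwi.mono_measure (Measure.prod_mono le_rfl Measure.restrict_le_self)
    apply ae_eq_zero_of_integral_mul_test hs
    · exact hwA.integral_prod_left
    intro φ hφ
    have e1 := integral_integral_swap (f := fun x y => w (x, y) * φ x)
      ((hφi φ hφ).mono_measure (Measure.prod_mono le_rfl (Measure.restrict_le_self (s := A))))
    simp only [integral_mul_const] at e1
    rw [e1]
    have := ae_restrict_of_ae (s := A) (step1 φ hφ)
    rw [integral_congr_ae this]
    simp
  rw [restrict_prod_eq, setIntegral_prod _ hwi.integrableOn]
  have := ae_restrict_of_ae (s := B) step2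
  rw [integral_congr_ae this]
  simp

/-- A function on a rectangle whose weak derivative in the first variable vanishes does not depend
on this variable. -/
theorem exists_ae_eq_comp_snd_of_hasWeakDeriv_zero {a b : ℝ} {t : Set ℝ} (hab : a < b)
    (ht : IsOpen t) {w : ℝ × ℝ → ℝ} (hw : IntegrableOn w (Ioo a b ×ˢ t))
    (h : HasWeakDeriv (Ioo a b ×ˢ t) 1 0 w 0) :
    ∃ k : ℝ → ℝ, IntegrableOn k t ∧
      w =ᵐ[volume.restrict (Ioo a b ×ˢ t)] fun p => k p.2 := by
  obtain ⟨ρ, hρ, hρ1⟩ := exists_isTestFunction₁_integral_eq_one hab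
  have hwi : Integrable w ((volume.restrict (Ioo a b)).prod (volume.restrict t)) := by
    rw [← restrict_prod_eq]; exact hw
  have hwρ : Integrable (fun p : ℝ × ℝ => w p * ρ p.1)
      ((volume.restrict (Ioo a b)).prod (volume.restrict t)) := by
    obtain ⟨C, hC⟩ := hρ.compact.exists_bound_of_continuous hρ.smooth.continuous
    exact hwi.mul_bdd (hρ.smooth.continuous.comp continuous_fst).aestronglyMeasurable
      (ae_of_all _ fun p => hC p.1)
  -- Du Bois-Reymond's argument: if `w` does not depend on `x`, this weighted mean recovers it.
  -- Conversely, `φ - m ρ` has mean zero, hence is the derivative of a test function and is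
  -- annihilated by `w`.
  set k : ℝ → ℝ := fun y => ∫ x in Ioo a b, w (x, y) * ρ x with hk
  have hki : IntegrableOn k t := hwρ.integral_prod_right
  have hk2 : IntegrableOn (fun p : ℝ × ℝ => k p.2) (Ioo a b ×ˢ t) := by
    rw [IntegrableOn, restrict_prod_eq]
    exact hki.comp_snd _
  refine ⟨k, hki, ?_⟩
  have key : (fun p => w p - k p.2) =ᵐ[volume.restrict (Ioo a b ×ˢ t)] 0 := by
    apply ae_eq_zero_of_integral_mul_prod_test isOpen_Ioo ht (hw.sub hk2)
    intro φ η hφ hη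
    set m := ∫ x in Ioo a b, φ x with hm
    have hθ : IsTestFunction₁ (Ioo a b) (fun x => φ x - m * ρ x) := by
      refine ⟨hφ.smooth.sub (contDiff_const.mul hρ.smooth), ?_, ?_⟩
      · exact hφ.compact.sub (hρ.compact.mul_left (f := fun _ => m))
      · refine (tsupport_sub _ _).trans (union_subset hφ.support_subset ?_)
        exact (tsupport_mul_subset_right (f := fun _ => m)).trans hρ.support_subset
    have hθ0 : ∫ x in Ioo a b, (φ x - m * ρ x) = 0 := by
      rw [integral_sub, integral_const_mul, hρ1, mul_one, sub_self]
      · exact (hφ.smooth.continuous.integrable_of_hasCompactSupport hφ.compact).integrableOn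
      · exact ((hρ.smooth.continuous.integrable_of_hasCompactSupport
          hρ.compact).integrableOn).const_mul m
    obtain ⟨Φ, hΦ, hΦ'⟩ := hθ.exists_primitive hab hθ0
    have e1 := h _ (hΦ.prod hη)
    have e2 : ∫ p in Ioo a b ×ˢ t, w p * ((φ p.1 - m * ρ p.1) * η p.2) = 0 := by
      simpa [partialX_mul hΦ.smooth hη.smooth, hΦ'] using e1
    have e3 : ∫ p in Ioo a b ×ˢ t, w p * (φ p.1 * η p.2) =
        m * ∫ p in Ioo a b ×ˢ t, w p * (ρ p.1 * η p.2) := by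
      rw [← integral_const_mul, ← sub_eq_zero, ← integral_sub, ← e2]
      · congr 1; ext p; ring
      · exact (hφ.prod hη).integrable_mul hw
      · exact ((hρ.prod hη).integrable_mul hw).const_mul m
    have e4 : ∫ p in Ioo a b ×ˢ t, w p * (ρ p.1 * η p.2) = ∫ y in t, k y * η y := by
      rw [restrict_prod_eq, integral_prod_symm]
      · apply integral_congr_ae (ae_of_all _ fun y => ?_)
        simp only [← mul_assoc, hk]
        rw [integral_mul_const]
      · rw [← restrict_prod_eq]
        exact (hρ.prod hη).integrable_mul hw
    have e5 : ∫ p in Ioo a b ×ˢ t, k p.2 * (φ p.1 * η p.2) = m * ∫ y in t, k y * η y := by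
      rw [restrict_prod_eq, hm, ← integral_prod_mul]
      congr 1; ext p; ring
    have e6 := integral_sub ((hφ.prod hη).integrable_mul hw) ((hφ.prod hη).integrable_mul hk2)
    rw [e3, e4, e5, sub_self] at e6
    refine Eq.trans ?_ e6
    congr 1
    ext p
    exact sub_mul _ _ _
  filter_upwards [key] with p hp
  exact sub_eq_zero.mp hp

/-! ### Primitives in the first variable -/

/-- The primitive of `g` in the first variable. -/
noncomputable def primX (a : ℝ) (g : ℝ × ℝ → ℝ) (p : ℝ × ℝ) : ℝ := ∫ s in a..p.1, g (s, p.2)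

theorem ae_ae_of_ae_rectangle {s t : Set ℝ} {P : ℝ × ℝ → Prop}
    (h : ∀ᵐ p ∂(volume.restrict (s ×ˢ t)), P p) :
    ∀ᵐ y ∂(volume.restrict t), ∀ᵐ x ∂(volume.restrict s), P (x, y) := by
  rw [restrict_prod_eq] at h
  have h' := (Measure.measurePreserving_swap (μ := volume.restrict t)
    (ν := volume.restrict s)).quasiMeasurePreserving.ae h
  exact Measure.ae_ae_of_ae_prod h'

theorem ae_integrableOn_slice {s t : Set ℝ} {g : ℝ × ℝ → ℝ} (hg : IntegrableOn g (s ×ˢ t)) :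
    ∀ᵐ y ∂(volume.restrict t), IntegrableOn (fun x => g (x, y)) s := by
  rw [IntegrableOn, restrict_prod_eq] at hg
  exact hg.prod_left_ae

theorem ae_of_ae_slice {s t : Set ℝ} {P : ℝ → Prop} (h : ∀ᵐ y ∂(volume.restrict t), P y) :
    ∀ᵐ p ∂(volume.restrict (s ×ˢ t)), P p.2 := by
  rw [restrict_prod_eq]
  exact Measure.quasiMeasurePreserving_snd.ae h

theorem ae_rectangle_mem {s t : Set ℝ} (hs : MeasurableSet s) (ht : MeasurableSet t) :
    ∀ᵐ p ∂(volume.restrict (s ×ˢ t)), p.1 ∈ s ∧ p.2 ∈ t := by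
  filter_upwards [ae_restrict_mem (hs.prod ht)] with p hp using hp

theorem primX_congr {a b : ℝ} {t : Set ℝ} (ht : MeasurableSet t) {g g' : ℝ × ℝ → ℝ}
    (h : g =ᵐ[volume.restrict (Ioo a b ×ˢ t)] g') :
    primX a g =ᵐ[volume.restrict (Ioo a b ×ˢ t)] primX a g' := by
  filter_upwards [ae_of_ae_slice (s := Ioo a b) (ae_ae_of_ae_rectangle h),
    ae_rectangle_mem measurableSet_Ioo ht] with p hp hmem
  apply intervalIntegral.integral_congr_ae
  rw [ae_restrict_iff' measurableSet_Ioo] at hp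
  filter_upwards [hp] with x hx hx'
  rw [uIoc_of_le hmem.1.1.le] at hx'
  exact hx ⟨hx'.1, hx'.2.trans_lt hmem.1.2⟩

theorem integrableOn_slice_integral {s t : Set ℝ} {g : ℝ × ℝ → ℝ}
    (hg : IntegrableOn g (s ×ˢ t)) : IntegrableOn (fun y => ∫ x in s, g (x, y)) t := by
  rw [IntegrableOn, restrict_prod_eq] at hg
  exact hg.integral_prod_right

theorem integrableOn_comp_snd {s t : Set ℝ} [IsFiniteMeasure (volume.restrict s)] {k : ℝ → ℝ}
    (hk : IntegrableOn k t) : IntegrableOn (fun p : ℝ × ℝ => k p.2) (s ×ˢ t) := by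
  rw [IntegrableOn, restrict_prod_eq]
  exact Integrable.comp_snd hk _

theorem abs_primX_le {a b : ℝ} {t : Set ℝ} (ht : MeasurableSet t) {g : ℝ × ℝ → ℝ}
    (hg : IntegrableOn g (Ioo a b ×ˢ t)) :
    ∀ᵐ p ∂(volume.restrict (Ioo a b ×ˢ t)), |primX a g p| ≤ ∫ x in Ioo a b, |g (x, p.2)| := by
  filter_upwards [ae_of_ae_slice (s := Ioo a b) (ae_integrableOn_slice hg),
    ae_rectangle_mem measurableSet_Ioo ht] with p hp hmem
  exact abs_intervalIntegral_le hp (left_mem_Icc.mpr (hmem.1.1.trans hmem.1.2).le)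
    (Ioo_subset_Icc_self hmem.1)

theorem integrableOn_primX {a b : ℝ} {t : Set ℝ} (ht : MeasurableSet t) {g : ℝ × ℝ → ℝ}
    (hg : IntegrableOn g (Ioo a b ×ˢ t)) : IntegrableOn (primX a g) (Ioo a b ×ˢ t) := by
  have hb : IntegrableOn (fun p : ℝ × ℝ => ∫ x in Ioo a b, |g (x, p.2)|) (Ioo a b ×ˢ t) :=
    integrableOn_comp_snd (k := fun y => ∫ x in Ioo a b, |g (x, y)|)
      (integrableOn_slice_integral hg.abs)
  refine Integrable.mono' hb ?_ (abs_primX_le ht hg)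
  obtain ⟨g', hg', hgg'⟩ := hg.aestronglyMeasurable
  refine AEStronglyMeasurable.congr ?_ (primX_congr ht hgg').symm
  -- Writing the variable upper limit as an indicator makes the primitive an integral with a
  -- parameter, whose measurability is standard.
  have hF : StronglyMeasurable (fun q : (ℝ × ℝ) × ℝ =>
      (Ioc a q.1.1).indicator (fun s => g' (s, q.1.2)) q.2) := by
    have hset : MeasurableSet {q : (ℝ × ℝ) × ℝ | q.2 ∈ Ioc a q.1.1} := by
      apply MeasurableSet.inter
      · exact measurableSet_lt measurable_const measurable_snd
      · exact measurableSet_le measurable_snd (measurable_fst.comp measurable_fst)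
    have := (hg'.comp_measurable (g := fun q : (ℝ × ℝ) × ℝ => (q.2, q.1.2))
      (by fun_prop)).indicator hset
    convert this using 1
    ext q
    simp only [indicator_apply, mem_ofPred_eq, Function.comp]
  have hG : StronglyMeasurable (fun p : ℝ × ℝ =>
      ∫ s, (Ioc a p.1).indicator (fun s => g' (s, p.2)) s) := hF.integral_prod_right
  refine hG.aestronglyMeasurable.congr ?_
  filter_upwards [ae_rectangle_mem measurableSet_Ioo ht] with p hmem
  rw [primX, intervalIntegral.integral_of_le hmem.1.1.le, integral_indicator measurableSet_Ioc]

theorem IsTestFunction.slice_eq_zero {s t : Set ℝ} {φ : ℝ × ℝ → ℝ}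
    (h : IsTestFunction (s ×ˢ t) φ) {x y : ℝ} (hx : x ∉ s) : φ (x, y) = 0 :=
  image_eq_zero_of_notMem_tsupport fun hmem => hx (h.support_subset hmem).1

theorem deriv_slice {φ : ℝ × ℝ → ℝ} (h : ContDiff ℝ ∞ φ) (x y : ℝ) :
    deriv (fun x => φ (x, y)) x = partialX φ (x, y) := by
  have hd : HasFDerivAt φ (fderiv ℝ φ (x, y)) (x, y) :=
    ((h.differentiable (by simp)) _).hasFDerivAt
  have hs : HasDerivAt (fun x : ℝ => (x, y)) ((1 : ℝ), (0 : ℝ)) x :=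
    (hasDerivAt_id x).prodMk (hasDerivAt_const x y)
  exact (hd.comp_hasDerivAt x hs).deriv

/-- Fubini and integration by parts on each slice. Nothing is asked of `k`, since the integrability
of `u` is assumed directly. -/
theorem hasWeakDeriv_of_eq_primX {a b : ℝ} {t : Set ℝ} (hab : a ≤ b)
    {u g : ℝ × ℝ → ℝ} {k : ℝ → ℝ} (hu : IntegrableOn u (Ioo a b ×ˢ t))
    (hg : IntegrableOn g (Ioo a b ×ˢ t))
    (h : u =ᵐ[volume.restrict (Ioo a b ×ˢ t)] fun p => k p.2 + primX a g p) :
    HasWeakDeriv (Ioo a b ×ˢ t) 1 0 u g := by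
  intro φ hφ
  have e1 : ∫ p in Ioo a b ×ˢ t, u p * partialX φ p =
      ∫ y in t, ∫ x in Ioo a b, u (x, y) * partialX φ (x, y) := by
    rw [restrict_prod_eq, integral_prod_symm]
    rw [← restrict_prod_eq]
    exact hφ.partialX.integrable_mul hu
  have e2 : ∫ p in Ioo a b ×ˢ t, g p * φ p = ∫ y in t, ∫ x in Ioo a b, g (x, y) * φ (x, y) := by
    rw [restrict_prod_eq, integral_prod_symm]
    rw [← restrict_prod_eq]
    exact hφ.integrable_mul hg
  simp only [Function.iterate_one, Function.iterate_zero, id]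
  rw [e1, e2, ← integral_const_mul]
  apply integral_congr_ae
  filter_upwards [ae_ae_of_ae_rectangle h, ae_integrableOn_slice hg] with y h1 h2
  have e3 : ∫ x in Ioo a b, u (x, y) * partialX φ (x, y) =
      ∫ x in Ioo a b, (k y + ∫ s in a..x, g (s, y)) * deriv (fun x => φ (x, y)) x := by
    apply integral_congr_ae
    filter_upwards [h1] with x hx
    rw [hx, deriv_slice hφ.smooth, primX]
  have hφs : ContDiff ℝ 1 (fun x => φ (x, y)) :=
    (hφ.smooth.of_le (by norm_cast)).comp (contDiff_id.prodMk contDiff_const)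
  rw [e3, ← intervalIntegral_eq_setIntegral_Ioo hab, ← intervalIntegral_eq_setIntegral_Ioo hab,
    integral_primitive_mul_deriv _ ((intervalIntegrable_iff_Ioo hab).mpr h2) hφs
      (hφ.slice_eq_zero (by simp)) (hφ.slice_eq_zero (by simp))]
  simp

/-- Subtracting the primitive of `g` leaves a function with zero weak `x`-derivative, which depends
on `y` only. -/
theorem HasWeakDeriv.exists_eq_primX {a b : ℝ} {t : Set ℝ} (hab : a < b) (ht : IsOpen t)
    {u g : ℝ × ℝ → ℝ} (h : HasWeakDeriv (Ioo a b ×ˢ t) 1 0 u g)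
    (hu : IntegrableOn u (Ioo a b ×ˢ t)) (hg : IntegrableOn g (Ioo a b ×ˢ t)) :
    ∃ k : ℝ → ℝ, IntegrableOn k t ∧
      u =ᵐ[volume.restrict (Ioo a b ×ˢ t)] fun p => k p.2 + primX a g p := by
  have hv := integrableOn_primX ht.measurableSet hg
  have hvg : HasWeakDeriv (Ioo a b ×ˢ t) 1 0 (primX a g) g :=
    hasWeakDeriv_of_eq_primX (k := 0) hab.le hv hg (by simp)
  have hw := h.add (hvg.const_mul (-1)) hu (hv.const_mul _) hg (hg.const_mul _)
  obtain ⟨k, hk, hk'⟩ := exists_ae_eq_comp_snd_of_hasWeakDeriv_zero hab ht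
    (hu.add (hv.const_mul (-1))) (hw.congr (by rfl) (by simp; rfl))
  refine ⟨k, hk, ?_⟩
  filter_upwards [hk'] with p hp
  have hp' : u p + -1 * primX a g p = k p.2 := hp
  linarith

/-! ### Slices of Sobolev functions -/

theorem ae_rectangle_swap {s t : Set ℝ} {P : ℝ × ℝ → Prop}
    (h : ∀ᵐ p ∂(volume.restrict (t ×ˢ s)), P p) :
    ∀ᵐ p ∂(volume.restrict (s ×ˢ t)), P p.swap := by
  rw [restrict_prod_eq] at h ⊢
  exact (Measure.measurePreserving_swap (μ := volume.restrict s)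
    (ν := volume.restrict t)).quasiMeasurePreserving.ae h

theorem ae_of_ae_slice' {s t : Set ℝ} {P : ℝ → Prop} (h : ∀ᵐ x ∂(volume.restrict s), P x) :
    ∀ᵐ p ∂(volume.restrict (s ×ˢ t)), P p.1 := by
  rw [restrict_prod_eq]
  exact Measure.quasiMeasurePreserving_fst.ae h

theorem integrableOn_of_continuousOn_Icc {a b c d : ℝ} {u : ℝ × ℝ → ℝ}
    (hu : ContinuousOn u (Icc a b ×ˢ Icc c d)) : IntegrableOn u (Ioo a b ×ˢ Ioo c d) :=
  (hu.integrableOn_compact (isCompact_Icc.prod isCompact_Icc)).mono_set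
    (prod_mono Ioo_subset_Icc_self Ioo_subset_Icc_self)

/-- On almost every slice both sides are continuous in `x` and agree almost everywhere, hence agree
up to the end points. This is where pointwise boundary values meet weak derivatives. -/
theorem HasWeakDeriv.eq_primitive {a b c d : ℝ} (hab : a < b) {u g : ℝ × ℝ → ℝ}
    (h : HasWeakDeriv (Ioo a b ×ˢ Ioo c d) 1 0 u g)
    (hu : ContinuousOn u (Icc a b ×ˢ Icc c d)) (hg : IntegrableOn g (Ioo a b ×ˢ Ioo c d)) :
    ∀ᵐ y ∂(volume.restrict (Ioo c d)), ∀ x ∈ Icc a b,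
      u (x, y) = u (a, y) + ∫ s in a..x, g (s, y) := by
  obtain ⟨k, -, hk⟩ := h.exists_eq_primX hab isOpen_Ioo (integrableOn_of_continuousOn_Icc hu) hg
  filter_upwards [ae_ae_of_ae_rectangle hk, ae_integrableOn_slice hg,
    ae_restrict_mem measurableSet_Ioo] with y h1 h2 hy
  have hc1 : ContinuousOn (fun x => u (x, y)) (Icc a b) :=
    hu.comp (by fun_prop) fun x hx => ⟨hx, Ioo_subset_Icc_self hy⟩
  have hc2 : ContinuousOn (fun x => k y + ∫ s in a..x, g (s, y)) (Icc a b) :=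
    continuousOn_const.add (continuousOn_primitive_Icc hab.le h2)
  have heq : EqOn (fun x => u (x, y)) (fun x => k y + ∫ s in a..x, g (s, y)) (Icc a b) := by
    refine Measure.eqOn_Icc_of_ae_eq volume hab.ne ?_ hc1 hc2
    rw [← restrict_Ioo_eq_restrict_Icc]
    exact h1
  have hka : u (a, y) = k y := by simpa using heq (left_mem_Icc.mpr hab.le)
  intro x hx
  rw [hka]
  exact heq hx

theorem HasWeakDeriv.eq_primitive' {a b c d : ℝ} (hcd : c < d) {u g : ℝ × ℝ → ℝ}
    (h : HasWeakDeriv (Ioo a b ×ˢ Ioo c d) 0 1 u g)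
    (hu : ContinuousOn u (Icc a b ×ˢ Icc c d)) (hg : IntegrableOn g (Ioo a b ×ˢ Ioo c d)) :
    ∀ᵐ x ∂(volume.restrict (Ioo a b)), ∀ y ∈ Icc c d,
      u (x, y) = u (x, c) + ∫ s in c..y, g (x, s) :=
  h.comp_swap.eq_primitive hcd
    (hu.comp continuous_swap.continuousOn fun _ hp => ⟨hp.2, hp.1⟩) (integrableOn_comp_swap hg)

/-- On almost every slice, the distance of a Sobolev function to its mean is bounded by the
integral of its derivative. -/
theorem HasWeakDeriv.abs_sub_mean_le {a b : ℝ} {t : Set ℝ} (hab : a < b) (ht : IsOpen t)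
    {u g : ℝ × ℝ → ℝ} (h : HasWeakDeriv (Ioo a b ×ˢ t) 1 0 u g)
    (hu : IntegrableOn u (Ioo a b ×ˢ t)) (hg : IntegrableOn g (Ioo a b ×ˢ t)) :
    ∀ᵐ p ∂(volume.restrict (Ioo a b ×ˢ t)),
      |u p - (∫ x in Ioo a b, u (x, p.2)) / (b - a)| ≤ ∫ x in Ioo a b, |g (x, p.2)| := by
  obtain ⟨k, -, hk⟩ := h.exists_eq_primX hab ht hu hg
  filter_upwards [hk, ae_of_ae_slice (s := Ioo a b) (ae_ae_of_ae_rectangle hk),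
    ae_of_ae_slice (s := Ioo a b) (ae_integrableOn_slice hg),
    ae_of_ae_slice (s := Ioo a b) (ae_integrableOn_slice hu),
    ae_rectangle_mem measurableSet_Ioo ht.measurableSet] with p h1 h2 h3 h4 hmem
  have hba : 0 < b - a := sub_pos.mpr hab
  have hsub : ∀ x ∈ Icc a b, IntervalIntegrable (fun s => g (s, p.2)) volume a x := fun x hx =>
    (((intervalIntegrable_iff_Ioo hab.le).mpr h3).mono_set (by
      rw [uIcc_of_le hx.1, uIcc_of_le hab.le]; exact Icc_subset_Icc_right hx.2))
  have e1 : ∫ x in Ioo a b, (u p - u (x, p.2)) =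
      (b - a) * u p - ∫ x in Ioo a b, u (x, p.2) := by
    rw [integral_sub (integrable_const _) h4]
    simp [hab.le]
  have e2 : |∫ x in Ioo a b, (u p - u (x, p.2))| ≤
      (∫ x in Ioo a b, |g (x, p.2)|) * (b - a) := by
    have := norm_setIntegral_le_of_norm_le_const_ae (μ := volume) (s := Ioo a b)
      (f := fun x => u p - u (x, p.2)) (C := ∫ x in Ioo a b, |g (x, p.2)|) (by simp) (by
        filter_upwards [h2, ae_restrict_mem measurableSet_Ioo] with x hx hmx
        rw [hx, h1, primX, primX]
        simp only [add_sub_add_left_eq_sub]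
        rw [intervalIntegral.integral_interval_sub_left (hsub _ (Ioo_subset_Icc_self hmem.1))
          (hsub _ (Ioo_subset_Icc_self hmx))]
        exact abs_intervalIntegral_le h3 (Ioo_subset_Icc_self hmx) (Ioo_subset_Icc_self hmem.1))
    simpa [Measure.real, hab.le] using this
  rw [e1] at e2
  have e3 : u p - (∫ x in Ioo a b, u (x, p.2)) / (b - a) =
      ((b - a) * u p - ∫ x in Ioo a b, u (x, p.2)) / (b - a) := by field_simp
  rw [e3, abs_div, abs_of_pos hba, div_le_iff₀ hba]
  exact e2

theorem HasWeakDeriv.abs_sub_mean_le' {c d : ℝ} {s : Set ℝ} (hcd : c < d) (hs : IsOpen s)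
    {u g : ℝ × ℝ → ℝ} (h : HasWeakDeriv (s ×ˢ Ioo c d) 0 1 u g)
    (hu : IntegrableOn u (s ×ˢ Ioo c d)) (hg : IntegrableOn g (s ×ˢ Ioo c d)) :
    ∀ᵐ p ∂(volume.restrict (s ×ˢ Ioo c d)),
      |u p - (∫ y in Ioo c d, u (p.1, y)) / (d - c)| ≤ ∫ y in Ioo c d, |g (p.1, y)| :=
  ae_rectangle_swap (h.comp_swap.abs_sub_mean_le hcd hs (integrableOn_comp_swap hu)
    (integrableOn_comp_swap hg))

/-! ### Inequalities between integrals -/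

theorem sq_integral_abs_le {α : Type*} [MeasurableSpace α] {μ : Measure α} [IsFiniteMeasure μ]
    {g : α → ℝ} (hg : MemLp g 2 μ) : (∫ x, |g x| ∂μ) ^ 2 ≤ μ.real univ * ∫ x, g x ^ 2 ∂μ := by
  rcases eq_or_ne (μ.real univ) 0 with h0 | h0
  · have : μ = 0 := by
      rw [Measure.real, ENNReal.toReal_eq_zero_iff] at h0
      simpa using h0
    simp [this]
  have hpos : 0 < μ.real univ := lt_of_le_of_ne measureReal_nonneg h0.symm
  set M := μ.real univ
  set m := (∫ x, |g x| ∂μ) / M with hm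
  have h1 : Integrable (fun x => |g x|) μ := (hg.integrable one_le_two).abs
  have h2 : Integrable (fun x => g x ^ 2) μ := hg.integrable_sq
  -- Cauchy–Schwarz against the constant `1`, read off from the nonnegativity of the variance of
  -- `|g|`.
  have key : 0 ≤ ∫ x, (|g x| - m) ^ 2 ∂μ := integral_nonneg fun _ => sq_nonneg _
  have e : ∫ x, (|g x| - m) ^ 2 ∂μ =
      ∫ x, g x ^ 2 ∂μ - 2 * m * ∫ x, |g x| ∂μ + m ^ 2 * M := by
    have : ∀ x, (|g x| - m) ^ 2 = g x ^ 2 - 2 * m * |g x| + m ^ 2 := fun x => by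
      rw [sub_sq, sq_abs]; ring
    simp only [this]
    have h3 : Integrable (fun x => g x ^ 2 - 2 * m * |g x|) μ := h2.sub (h1.const_mul _)
    rw [integral_add h3 (integrable_const _), integral_sub h2 (h1.const_mul _), integral_const_mul, integral_const, smul_eq_mul]
    ring
  have e' : (∫ x, |g x| ∂μ) = m * M := by rw [hm]; field_simp
  rw [e, e'] at key
  rw [e']
  nlinarith

theorem memLp_slice {s t : Set ℝ} {g : ℝ × ℝ → ℝ}
    (hg : MemLp g 2 (volume.restrict (s ×ˢ t))) :
    ∀ᵐ y ∂(volume.restrict t), MemLp (fun x => g (x, y)) 2 (volume.restrict s) := by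
  have h2 : Integrable (fun p => g p ^ 2) (volume.restrict (s ×ˢ t)) := hg.integrable_sq
  have hm := hg.aestronglyMeasurable
  rw [restrict_prod_eq] at hm
  have hm' : ∀ᵐ y ∂(volume.restrict t), AEStronglyMeasurable (fun x => g (x, y))
      (volume.restrict s) := by
    have := hm.prod_swap.prodMk_left
    simpa using this
  filter_upwards [hm', ae_integrableOn_slice h2] with y h3 h4
  exact (memLp_two_iff_integrable_sq h3).mpr h4

/-- Turns a slicewise `L¹` bound into an `L²` bound: `(A + I)² ≤ 2A² + 2I²`, then Cauchy–Schwarz on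
the slice and Fubini. -/
theorem integral_sq_le_of_abs_le {s t : Set ℝ} [IsFiniteMeasure (volume.restrict s)]
    [IsFiniteMeasure (volume.restrict t)] {G g : ℝ × ℝ → ℝ} {A : ℝ}
    (hG : MemLp G 2 (volume.restrict (s ×ˢ t))) (hg : MemLp g 2 (volume.restrict (s ×ˢ t)))
    (h : ∀ᵐ p ∂(volume.restrict (s ×ˢ t)), |G p| ≤ A + ∫ x in s, |g (x, p.2)|) :
    ∫ p in s ×ˢ t, G p ^ 2 ≤ 2 * A ^ 2 * (volume.real s * volume.real t) +
      2 * volume.real s ^ 2 * ∫ p in s ×ˢ t, g p ^ 2 := by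
  have hg2 : IntegrableOn (fun p => g p ^ 2) (s ×ˢ t) := hg.integrable_sq
  have hsl := integrableOn_slice_integral hg2
  have hint : Integrable (fun p : ℝ × ℝ => 2 * A ^ 2 +
      2 * volume.real s * ∫ x in s, g (x, p.2) ^ 2) (volume.restrict (s ×ˢ t)) := by
    rw [restrict_prod_eq]
    refine (integrable_const _).add (Integrable.const_mul ?_ _)
    exact Integrable.comp_snd hsl _
  have e : ∫ p in s ×ˢ t, (2 * A ^ 2 + 2 * volume.real s * ∫ x in s, g (x, p.2) ^ 2) =
      2 * A ^ 2 * (volume.real s * volume.real t) +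
      2 * volume.real s ^ 2 * ∫ p in s ×ˢ t, g p ^ 2 := by
    rw [restrict_prod_eq] at hint ⊢
    rw [integral_prod_symm _ hint]
    simp only [integral_const]
    have hg3 := hg2
    rw [IntegrableOn, restrict_prod_eq] at hg3
    simp only [smul_eq_mul]
    rw [integral_const_mul, integral_add (integrable_const _) (hsl.const_mul _),
      integral_const_mul (2 * volume.real s), integral_prod_symm _ hg3]
    simp
    ring
  rw [← e]
  apply integral_mono_ae hG.integrable_sq hint
  filter_upwards [h, ae_of_ae_slice (s := s) (memLp_slice hg)] with p h1 h2
  have h3 := sq_integral_abs_le h2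
  have h4 : G p ^ 2 ≤ (A + ∫ x in s, |g (x, p.2)|) ^ 2 := by
    rw [← sq_abs]
    exact pow_le_pow_left₀ (abs_nonneg _) h1 2
  simp only [measureReal_restrict_apply MeasurableSet.univ, univ_inter] at h3
  nlinarith [sq_nonneg (A - ∫ x in s, |g (x, p.2)|)]

/-! ### Elements of `H²_*` together with their weak derivatives -/

/-- `u ∈ H²_*` with first and second order weak derivatives `gx`, `gy`, `gxx`, `gxy`, `gyy`. -/
structure IsJet (L ℓ : ℝ) (u gx gy gxx gxy gyy : ℝ × ℝ → ℝ) : Prop where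
  continuousOn : ContinuousOn u (closedPlate L ℓ)
  left : ∀ y ∈ Ioo (-ℓ) ℓ, u (0, y) = 0
  right : ∀ y ∈ Ioo (-ℓ) ℓ, u (L, y) = 0
  x : IsL2WeakDeriv (plate L ℓ) 1 0 u gx
  y : IsL2WeakDeriv (plate L ℓ) 0 1 u gy
  xx : IsL2WeakDeriv (plate L ℓ) 2 0 u gxx
  xy : IsL2WeakDeriv (plate L ℓ) 1 1 u gxy
  yy : IsL2WeakDeriv (plate L ℓ) 0 2 u gyy

instance isFiniteMeasure_restrict_plate (L ℓ : ℝ) :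
    IsFiniteMeasure (volume.restrict (plate L ℓ)) := by
  rw [plate, restrict_prod_eq]
  infer_instance

theorem isOpen_plate (L ℓ : ℝ) : IsOpen (plate L ℓ) := isOpen_Ioo.prod isOpen_Ioo

theorem plate_subset_closedPlate (L ℓ : ℝ) : plate L ℓ ⊆ closedPlate L ℓ :=
  prod_mono Ioo_subset_Icc_self Ioo_subset_Icc_self

theorem isCompact_closedPlate (L ℓ : ℝ) : IsCompact (closedPlate L ℓ) :=
  isCompact_Icc.prod isCompact_Icc

theorem closure_plate {L ℓ : ℝ} (hL : 0 < L) (hℓ : 0 < ℓ) :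
    closure (plate L ℓ) = closedPlate L ℓ := by
  rw [plate, closure_prod_eq, closure_Ioo hL.ne, closure_Ioo (by linarith), closedPlate]

theorem measureReal_plate {L ℓ : ℝ} (hL : 0 < L) (hℓ : 0 < ℓ) :
    (volume.restrict (plate L ℓ)).real univ = 2 * ℓ * L := by
  rw [plate, restrict_prod_eq, ← univ_prod_univ, measureReal_prod_prod]
  simp [hL.le, hℓ.le]
  ring

theorem memLp_of_continuousOn_closedPlate {L ℓ : ℝ} {u : ℝ × ℝ → ℝ}
    (hu : ContinuousOn u (closedPlate L ℓ)) : MemLp u 2 (volume.restrict (plate L ℓ)) := by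
  obtain ⟨C, hC⟩ := (isCompact_closedPlate L ℓ).exists_bound_of_continuousOn hu
  refine MemLp.of_bound ((hu.mono (plate_subset_closedPlate L ℓ)).aestronglyMeasurable
    (isOpen_plate L ℓ).measurableSet) C ?_
  filter_upwards [ae_restrict_mem (isOpen_plate L ℓ).measurableSet] with p hp
  exact hC p (plate_subset_closedPlate L ℓ hp)

theorem weakDeriv_spec {Ω : Set (ℝ × ℝ)} {i j : ℕ} {u : ℝ × ℝ → ℝ}
    (h : ∃ g, IsL2WeakDeriv Ω i j u g) : IsL2WeakDeriv Ω i j u (weakDeriv Ω i j u) := by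
  rw [weakDeriv, dif_pos h]
  exact h.choose_spec

theorem MemH2Star.isJet {L ℓ : ℝ} {u : ℝ × ℝ → ℝ} (h : MemH2Star L ℓ u) :
    IsJet L ℓ u (weakDeriv (plate L ℓ) 1 0 u) (weakDeriv (plate L ℓ) 0 1 u)
      (weakDeriv (plate L ℓ) 2 0 u) (weakDeriv (plate L ℓ) 1 1 u)
      (weakDeriv (plate L ℓ) 0 2 u) where
  continuousOn := h.continuousOn
  left := h.left
  right := h.right
  x := weakDeriv_spec (h.memH2.2 1 0 (by norm_num))
  y := weakDeriv_spec (h.memH2.2 0 1 (by norm_num))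
  xx := weakDeriv_spec (h.memH2.2 2 0 (by norm_num))
  xy := weakDeriv_spec (h.memH2.2 1 1 (by norm_num))
  yy := weakDeriv_spec (h.memH2.2 0 2 (by norm_num))

theorem IsL2WeakDeriv.ae_eq {L ℓ : ℝ} {i j : ℕ} {u g h : ℝ × ℝ → ℝ}
    (hg : IsL2WeakDeriv (plate L ℓ) i j u g) (hh : IsL2WeakDeriv (plate L ℓ) i j u h) :
    g =ᵐ[volume.restrict (plate L ℓ)] h :=
  hg.2.ae_eq (isOpen_plate L ℓ) hh.2 (hg.1.integrable one_le_two) (hh.1.integrable one_le_two)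

theorem IsL2WeakDeriv.add {L ℓ : ℝ} {i j : ℕ} {u v g h : ℝ × ℝ → ℝ}
    (hu : MemLp u 2 (volume.restrict (plate L ℓ))) (hv : MemLp v 2 (volume.restrict (plate L ℓ)))
    (hg : IsL2WeakDeriv (plate L ℓ) i j u g) (hh : IsL2WeakDeriv (plate L ℓ) i j v h) :
    IsL2WeakDeriv (plate L ℓ) i j (fun p => u p + v p) (fun p => g p + h p) :=
  ⟨hg.1.add hh.1, hg.2.add hh.2 (hu.integrable one_le_two) (hv.integrable one_le_two)
    (hg.1.integrable one_le_two) (hh.1.integrable one_le_two)⟩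

theorem IsL2WeakDeriv.const_mul {Ω : Set (ℝ × ℝ)} {i j : ℕ} {u g : ℝ × ℝ → ℝ}
    (hg : IsL2WeakDeriv Ω i j u g) (r : ℝ) :
    IsL2WeakDeriv Ω i j (fun p => r * u p) (fun p => r * g p) :=
  ⟨hg.1.const_mul r, hg.2.const_mul r⟩

namespace IsJet

variable {L ℓ : ℝ} {u gx gy gxx gxy gyy v hx hy hxx hxy hyy : ℝ × ℝ → ℝ}

theorem memLp (h : IsJet L ℓ u gx gy gxx gxy gyy) : MemLp u 2 (volume.restrict (plate L ℓ)) :=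
  memLp_of_continuousOn_closedPlate h.continuousOn

theorem memH2Star (h : IsJet L ℓ u gx gy gxx gxy gyy) : MemH2Star L ℓ u where
  memH2 := by
    refine ⟨h.memLp, fun i j hij => ?_⟩
    have hi : i ≤ 2 := by omega
    have hj : j ≤ 2 := by omega
    interval_cases i <;> interval_cases j
    · exact ⟨u, h.memLp, hasWeakDeriv_zero_zero⟩
    · exact ⟨gy, h.y⟩
    · exact ⟨gyy, h.yy⟩
    · exact ⟨gx, h.x⟩
    · exact ⟨gxy, h.xy⟩
    · omega
    · exact ⟨gxx, h.xx⟩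
    · omega
    · omega
  continuousOn := h.continuousOn
  left := h.left
  right := h.right

theorem add (h : IsJet L ℓ u gx gy gxx gxy gyy) (h' : IsJet L ℓ v hx hy hxx hxy hyy) :
    IsJet L ℓ (fun p => u p + v p) (fun p => gx p + hx p) (fun p => gy p + hy p)
      (fun p => gxx p + hxx p) (fun p => gxy p + hxy p) (fun p => gyy p + hyy p) where
  continuousOn := h.continuousOn.add h'.continuousOn
  left y hy := by rw [h.left y hy, h'.left y hy, add_zero]
  right y hy := by rw [h.right y hy, h'.right y hy, add_zero]
  x := h.x.add h.memLp h'.memLp h'.x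
  y := h.y.add h.memLp h'.memLp h'.y
  xx := h.xx.add h.memLp h'.memLp h'.xx
  xy := h.xy.add h.memLp h'.memLp h'.xy
  yy := h.yy.add h.memLp h'.memLp h'.yy

theorem const_mul (h : IsJet L ℓ u gx gy gxx gxy gyy) (r : ℝ) :
    IsJet L ℓ (fun p => r * u p) (fun p => r * gx p) (fun p => r * gy p)
      (fun p => r * gxx p) (fun p => r * gxy p) (fun p => r * gyy p) where
  continuousOn := continuousOn_const.mul h.continuousOn
  left y hy := by rw [h.left y hy, mul_zero]
  right y hy := by rw [h.right y hy, mul_zero]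
  x := h.x.const_mul r
  y := h.y.const_mul r
  xx := h.xx.const_mul r
  xy := h.xy.const_mul r
  yy := h.yy.const_mul r

theorem sub (h : IsJet L ℓ u gx gy gxx gxy gyy) (h' : IsJet L ℓ v hx hy hxx hxy hyy) :
    IsJet L ℓ (fun p => u p - v p) (fun p => gx p - hx p) (fun p => gy p - hy p)
      (fun p => gxx p - hxx p) (fun p => gxy p - hxy p) (fun p => gyy p - hyy p) := by
  simpa [sub_eq_add_neg] using h.add (h'.const_mul (-1))

/-! ### Poincaré estimates on slices and the embedding into bounded functions, with explicit
constants. -/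

variable (hL : 0 < L) (hℓ : 0 < ℓ) (h : IsJet L ℓ u gx gy gxx gxy gyy)
include h

theorem hasWeakDeriv_x_x : HasWeakDeriv (plate L ℓ) 1 0 gx gxx :=
  HasWeakDeriv.of_trans (i := 1) (j := 0) h.x.2 h.xx.2

theorem hasWeakDeriv_x_y : HasWeakDeriv (plate L ℓ) 0 1 gx gxy :=
  HasWeakDeriv.of_trans (i := 1) (j := 0) h.x.2 h.xy.2

theorem hasWeakDeriv_y_y : HasWeakDeriv (plate L ℓ) 0 1 gy gyy :=
  HasWeakDeriv.of_trans (i := 0) (j := 1) h.y.2 h.yy.2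

include hL in
theorem eq_primitive : ∀ᵐ y ∂(volume.restrict (Ioo (-ℓ) ℓ)), ∀ x ∈ Icc 0 L,
    u (x, y) = ∫ s in 0..x, gx (s, y) := by
  filter_upwards [h.x.2.eq_primitive hL h.continuousOn (h.x.1.integrable one_le_two),
    ae_restrict_mem measurableSet_Ioo] with y h1 hy x hx
  rw [h1 x hx, h.left y hy, zero_add]

include hL in
theorem integral_x_eq_zero : ∀ᵐ y ∂(volume.restrict (Ioo (-ℓ) ℓ)),
    ∫ x in Ioo 0 L, gx (x, y) = 0 := by
  filter_upwards [h.eq_primitive hL, ae_restrict_mem measurableSet_Ioo] with y h1 hy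
  rw [← intervalIntegral_eq_setIntegral_Ioo hL.le, ← h1 L (right_mem_Icc.mpr hL.le),
    h.right y hy]

include hL in
-- `u_x` has mean zero on almost every horizontal slice because `u` vanishes at both hinged ends.
theorem abs_x_le : ∀ᵐ p ∂(volume.restrict (plate L ℓ)),
    |gx p| ≤ ∫ s in Ioo 0 L, |gxx (s, p.2)| := by
  filter_upwards [h.hasWeakDeriv_x_x.abs_sub_mean_le hL isOpen_Ioo
    (h.x.1.integrable one_le_two) (h.xx.1.integrable one_le_two),
    ae_of_ae_slice (s := Ioo 0 L) (h.integral_x_eq_zero hL)] with p h1 h2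
  simpa [h2] using h1

include hL in
theorem integral_abs_x_le :
    ∫ p in plate L ℓ, |gx p| ≤ L * ∫ p in plate L ℓ, |gxx p| := by
  have hi : IntegrableOn gxx (Ioo 0 L ×ˢ Ioo (-ℓ) ℓ) := h.xx.1.integrable one_le_two
  have hs := integrableOn_slice_integral hi.abs
  have e : ∫ p in plate L ℓ, (∫ s in Ioo 0 L, |gxx (s, p.2)|) =
      L * ∫ p in plate L ℓ, |gxx p| := by
    have hi' : Integrable (fun p => |gxx p|) (volume.restrict (Ioo 0 L ×ˢ Ioo (-ℓ) ℓ)) := hi.abs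
    rw [restrict_prod_eq] at hi'
    rw [plate, restrict_prod_eq, integral_prod_symm _ hi', integral_prod_symm]
    · simp [integral_const_mul, hL.le]
    · exact Integrable.comp_snd hs _
  rw [← e]
  refine integral_mono_ae (h.x.1.integrable one_le_two).abs ?_ (h.abs_x_le hL)
  exact integrableOn_comp_snd (s := Ioo 0 L) hs

include hℓ in
theorem abs_x_le' : ∀ᵐ p ∂(volume.restrict (plate L ℓ)),
    |gx p| ≤ (∫ t in Ioo (-ℓ) ℓ, |gx (p.1, t)|) / (2 * ℓ) +
      ∫ t in Ioo (-ℓ) ℓ, |gxy (p.1, t)| := by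
  filter_upwards [h.hasWeakDeriv_x_y.abs_sub_mean_le' (by linarith) isOpen_Ioo
    (h.x.1.integrable one_le_two) (h.xy.1.integrable one_le_two)] with p h1
  have e : ℓ - -ℓ = 2 * ℓ := by ring
  rw [e] at h1
  have h2 : |(∫ t in Ioo (-ℓ) ℓ, gx (p.1, t)) / (2 * ℓ)| ≤
      (∫ t in Ioo (-ℓ) ℓ, |gx (p.1, t)|) / (2 * ℓ) := by
    rw [abs_div, abs_of_pos (by linarith : 0 < 2 * ℓ)]
    gcongr
    exact abs_integral_le_integral_abs
  have h3 := abs_sub_abs_le_abs_sub (gx p) ((∫ t in Ioo (-ℓ) ℓ, gx (p.1, t)) / (2 * ℓ))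
  linarith

include hL hℓ in
-- Write `u` as the `x`-integral of `u_x`, and bound `u_x` at each `x` by its mean across the width
-- plus the variation `∫ |u_xy|`. The mean costs `1 / (2 * ℓ)`, and mean zero in `x` trades `∫
-- |u_x|` for `L * ∫ |u_xx|`. The second `y`-derivative does not enter.
theorem abs_apply_le {p : ℝ × ℝ} (hp : p ∈ closedPlate L ℓ) :
    |u p| ≤ L / (2 * ℓ) * (∫ p in plate L ℓ, |gxx p|) + ∫ p in plate L ℓ, |gxy p| := by
  set S := L / (2 * ℓ) * (∫ p in plate L ℓ, |gxx p|) + ∫ p in plate L ℓ, |gxy p| with hS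
  have hix : IntegrableOn gx (Ioo 0 L ×ˢ Ioo (-ℓ) ℓ) := h.x.1.integrable one_le_two
  have hixy : IntegrableOn gxy (Ioo 0 L ×ˢ Ioo (-ℓ) ℓ) := h.xy.1.integrable one_le_two
  set A : ℝ → ℝ := fun x => (∫ t in Ioo (-ℓ) ℓ, |gx (x, t)|) / (2 * ℓ) +
      ∫ t in Ioo (-ℓ) ℓ, |gxy (x, t)| with hA
  have hix' : Integrable (fun p => |gx p|) (volume.restrict (Ioo 0 L ×ˢ Ioo (-ℓ) ℓ)) := hix.abs
  have hixy' : Integrable (fun p => |gxy p|) (volume.restrict (Ioo 0 L ×ˢ Ioo (-ℓ) ℓ)) := hixy.abs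
  rw [restrict_prod_eq] at hix' hixy'
  have hA1 : IntegrableOn A (Ioo 0 L) :=
    (hix'.integral_prod_left.div_const _).add hixy'.integral_prod_left
  have hA2 : ∫ x in Ioo 0 L, A x ≤ S := by
    have e : ∫ x in Ioo 0 L, A x = (∫ p in plate L ℓ, |gx p|) / (2 * ℓ) +
        ∫ p in plate L ℓ, |gxy p| := by
      rw [plate, restrict_prod_eq, integral_prod _ hix', integral_prod _ hixy', ← integral_div,
        ← integral_add (hix'.integral_prod_left.div_const _) hixy'.integral_prod_left]
    rw [e, hS]
    have := h.integral_abs_x_le hL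
    gcongr
    rw [div_mul_eq_mul_div]
    gcongr
  have hae : ∀ᵐ p ∂(volume.restrict (plate L ℓ)), |u p| ≤ S := by
    filter_upwards [ae_of_ae_slice (s := Ioo 0 L) (h.eq_primitive hL),
      ae_of_ae_slice (s := Ioo 0 L) (ae_ae_of_ae_rectangle (h.abs_x_le' hℓ)),
      ae_of_ae_slice (s := Ioo 0 L) (ae_integrableOn_slice hix),
      ae_rectangle_mem measurableSet_Ioo measurableSet_Ioo] with p h1 h2 h3 hmem
    have hp1 : p.1 ∈ Icc 0 L := Ioo_subset_Icc_self hmem.1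
    rw [show u p = _ from h1 p.1 hp1]
    refine (abs_intervalIntegral_le h3 (left_mem_Icc.mpr hL.le) hp1).trans (le_trans ?_ hA2)
    exact integral_mono_ae h3.abs hA1 h2
  -- By continuity the set where the bound fails is open; being null, it is empty.
  have hopen : ∀ p ∈ plate L ℓ, |u p| ≤ S := by
    have hu : ContinuousOn (fun p => |u p|) (plate L ℓ) :=
      (h.continuousOn.mono (plate_subset_closedPlate L ℓ)).abs
    have ho : IsOpen (plate L ℓ ∩ (fun p => |u p|) ⁻¹' Ioi S) :=
      hu.isOpen_inter_preimage (isOpen_plate L ℓ) isOpen_Ioi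
    have h0 : volume (plate L ℓ ∩ (fun p => |u p|) ⁻¹' Ioi S) = 0 := by
      rw [ae_restrict_iff' (isOpen_plate L ℓ).measurableSet] at hae
      rw [measure_eq_zero_iff_ae_notMem]
      filter_upwards [hae] with p h1 h2
      exact absurd (h1 h2.1) (not_le.mpr h2.2)
    rw [ho.measure_eq_zero_iff volume] at h0
    intro p hp
    by_contra hcon
    have : p ∈ plate L ℓ ∩ (fun p => |u p|) ⁻¹' Ioi S := ⟨hp, not_le.mp hcon⟩
    rw [h0] at this
    exact this
  rw [← closure_plate hL hℓ] at hp
  exact le_on_closure hopen (by rw [closure_plate hL hℓ]; exact h.continuousOn.abs)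
    continuousOn_const hp

include hℓ in
-- No boundary condition is available at `y = ±ℓ`; the mean of `u_y` across the width is instead the
-- difference quotient of `u` between the free edges, at most `2 * S / (2 * ℓ)`.
theorem abs_y_le {S : ℝ} (hS : ∀ p ∈ closedPlate L ℓ, |u p| ≤ S) :
    ∀ᵐ p ∂(volume.restrict (plate L ℓ)),
      |gy p| ≤ S / ℓ + ∫ t in Ioo (-ℓ) ℓ, |gyy (p.1, t)| := by
  filter_upwards [h.hasWeakDeriv_y_y.abs_sub_mean_le' (by linarith) isOpen_Ioo
    (h.y.1.integrable one_le_two) (h.yy.1.integrable one_le_two),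
    ae_of_ae_slice' (t := Ioo (-ℓ) ℓ) (h.y.2.eq_primitive' (by linarith) h.continuousOn
      (h.y.1.integrable one_le_two)),
    ae_rectangle_mem measurableSet_Ioo measurableSet_Ioo] with p h1 h2 hmem
  have h3 := h2 ℓ (right_mem_Icc.mpr (by linarith))
  rw [intervalIntegral_eq_setIntegral_Ioo (by linarith)] at h3
  have h4 := hS (p.1, ℓ) ⟨Ioo_subset_Icc_self hmem.1, right_mem_Icc.mpr (by linarith)⟩
  have h5 := hS (p.1, -ℓ) ⟨Ioo_subset_Icc_self hmem.1, left_mem_Icc.mpr (by linarith)⟩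
  have e : ℓ - -ℓ = 2 * ℓ := by ring
  rw [e] at h1
  have h6 : |(∫ t in Ioo (-ℓ) ℓ, gy (p.1, t)) / (2 * ℓ)| ≤ S / ℓ := by
    rw [abs_div, abs_of_pos (by linarith : 0 < 2 * ℓ), div_le_div_iff₀ (by linarith) hℓ]
    have : |∫ t in Ioo (-ℓ) ℓ, gy (p.1, t)| ≤ 2 * S := by
      have h4' := abs_le.mp h4
      have h5' := abs_le.mp h5
      rw [abs_le]
      constructor <;> linarith [h4'.1, h4'.2, h5'.1, h5'.2]
    nlinarith
  have h7 := abs_sub_abs_le_abs_sub (gy p) ((∫ t in Ioo (-ℓ) ℓ, gy (p.1, t)) / (2 * ℓ))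
  linarith

include hL hℓ in
-- The constant grows only like `1 / ℓ` as `ℓ → 0`, which an energy of order `ℓ ^ 3` can afford.
theorem sq_apply_le {p : ℝ × ℝ} (hp : p ∈ closedPlate L ℓ) :
    u p ^ 2 ≤ (L / (2 * ℓ) + 1) ^ 2 * (4 * ℓ * L) *
      ((∫ p in plate L ℓ, gxx p ^ 2) + ∫ p in plate L ℓ, gxy p ^ 2) := by
  have h1 := h.abs_apply_le hL hℓ hp
  have h2 := sq_integral_abs_le h.xx.1
  have h3 := sq_integral_abs_le h.xy.1
  rw [measureReal_plate hL hℓ] at h2 h3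
  set X := ∫ p in plate L ℓ, |gxx p|
  set Y := ∫ p in plate L ℓ, |gxy p|
  have hX : 0 ≤ X := integral_nonneg fun _ => abs_nonneg _
  have hY : 0 ≤ Y := integral_nonneg fun _ => abs_nonneg _
  have hq : 0 ≤ L / (2 * ℓ) := by positivity
  have h4 : |u p| ≤ (L / (2 * ℓ) + 1) * (X + Y) := by nlinarith
  rw [← sq_abs]
  calc |u p| ^ 2 ≤ ((L / (2 * ℓ) + 1) * (X + Y)) ^ 2 := pow_le_pow_left₀ (abs_nonneg _) h4 2
    _ = (L / (2 * ℓ) + 1) ^ 2 * (X + Y) ^ 2 := by ring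
    _ ≤ (L / (2 * ℓ) + 1) ^ 2 * ((4 * ℓ * L) *
        ((∫ p in plate L ℓ, gxx p ^ 2) + ∫ p in plate L ℓ, gxy p ^ 2)) := by
      gcongr
      nlinarith [sq_nonneg (X - Y)]
    _ = _ := by ring

end IsJet

/-- The second derivatives control the full norm of `H²_*`. -/
theorem exists_integral_sq_le {L ℓ : ℝ} (hL : 0 < L) (hℓ : 0 < ℓ) : ∃ C : ℝ, 0 < C ∧
    ∀ u gx gy gxx gxy gyy : ℝ × ℝ → ℝ, IsJet L ℓ u gx gy gxx gxy gyy →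
      (∫ p in plate L ℓ, u p ^ 2) + (∫ p in plate L ℓ, gx p ^ 2) + (∫ p in plate L ℓ, gy p ^ 2) ≤
      C * ((∫ p in plate L ℓ, gxx p ^ 2) + (∫ p in plate L ℓ, gxy p ^ 2) +
        ∫ p in plate L ℓ, gyy p ^ 2) := by
  set D := (L / (2 * ℓ) + 1) ^ 2 * (4 * ℓ * L) with hD
  have hD0 : 0 < D := by positivity
  refine ⟨D * (2 * ℓ * L) + 2 * L ^ 2 + (2 * (D / ℓ ^ 2) * (2 * ℓ * L) + 2 * (2 * ℓ) ^ 2),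
    by positivity, ?_⟩
  intro u gx gy gxx gxy gyy h
  set N20 := ∫ p in plate L ℓ, gxx p ^ 2
  set N11 := ∫ p in plate L ℓ, gxy p ^ 2
  set N02 := ∫ p in plate L ℓ, gyy p ^ 2
  have p20 : 0 ≤ N20 := integral_nonneg fun _ => sq_nonneg _
  have p11 : 0 ≤ N11 := integral_nonneg fun _ => sq_nonneg _
  have p02 : 0 ≤ N02 := integral_nonneg fun _ => sq_nonneg _
  have hvol : volume.real (Ioo 0 L) = L := by simp [hL.le]
  have hvol' : volume.real (Ioo (-ℓ) ℓ) = 2 * ℓ := by simp [hℓ.le]; ring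
  have h1 : ∫ p in plate L ℓ, u p ^ 2 ≤ D * (2 * ℓ * L) * (N20 + N11) := by
    have : ∫ p in plate L ℓ, u p ^ 2 ≤ ∫ p in plate L ℓ, D * (N20 + N11) := by
      apply integral_mono_ae h.memLp.integrable_sq (integrable_const _)
      filter_upwards [ae_restrict_mem (isOpen_plate L ℓ).measurableSet] with p hp
      exact h.sq_apply_le hL hℓ (plate_subset_closedPlate L ℓ hp)
    rw [integral_const, measureReal_plate hL hℓ, smul_eq_mul] at this
    linarith
  have h2 : ∫ p in plate L ℓ, gx p ^ 2 ≤ 2 * L ^ 2 * N20 := by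
    have := integral_sq_le_of_abs_le (s := Ioo 0 L) (t := Ioo (-ℓ) ℓ) (A := 0) h.x.1 h.xx.1
      (by filter_upwards [h.abs_x_le hL] with p hp; rwa [zero_add])
    rw [hvol] at this
    refine this.trans (le_of_eq ?_)
    simp [N20, plate]
  have h3 : ∫ p in plate L ℓ, gy p ^ 2 ≤
      2 * (D / ℓ ^ 2) * (2 * ℓ * L) * (N20 + N11) + 2 * (2 * ℓ) ^ 2 * N02 := by
    have hS : ∀ p ∈ closedPlate L ℓ, |u p| ≤ √(D * (N20 + N11)) := fun p hp =>
      Real.abs_le_sqrt (h.sq_apply_le hL hℓ hp)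
    have hm : MemLp (gy ∘ Prod.swap) 2 (volume.restrict (Ioo (-ℓ) ℓ ×ˢ Ioo 0 L)) := by
      have := h.y.1
      rw [plate, restrict_prod_eq] at this
      rw [restrict_prod_eq]
      exact this.comp_measurePreserving Measure.measurePreserving_swap
    have hm' : MemLp (gyy ∘ Prod.swap) 2 (volume.restrict (Ioo (-ℓ) ℓ ×ˢ Ioo 0 L)) := by
      have := h.yy.1
      rw [plate, restrict_prod_eq] at this
      rw [restrict_prod_eq]
      exact this.comp_measurePreserving Measure.measurePreserving_swap
    have := integral_sq_le_of_abs_le hm hm' (ae_rectangle_swap (h.abs_y_le hℓ hS))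
    rw [hvol, hvol'] at this
    have e1 := setIntegral_prod_swap_eq (Ioo 0 L) (Ioo (-ℓ) ℓ) (fun p => gy p ^ 2)
    have e2 : _ = N02 := setIntegral_prod_swap_eq (Ioo 0 L) (Ioo (-ℓ) ℓ) (fun p => gyy p ^ 2)
    simp only [Function.comp] at this
    rw [e1, e2, div_pow, Real.sq_sqrt (by positivity)] at this
    refine this.trans (le_of_eq ?_)
    ring
  have q1 : 0 ≤ D * (2 * ℓ * L) := by positivity
  have q3 : 0 ≤ 2 * (D / ℓ ^ 2) * (2 * ℓ * L) := by positivity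
  have q2 : 0 ≤ 2 * L ^ 2 := by positivity
  have q4 : 0 ≤ 2 * (2 * ℓ) ^ 2 := by positivity
  generalize D * (2 * ℓ * L) = a1 at *
  generalize 2 * (D / ℓ ^ 2) * (2 * ℓ * L) = a3 at *
  generalize 2 * L ^ 2 = a2 at *
  generalize 2 * (2 * ℓ) ^ 2 = a4 at *
  nlinarith [mul_nonneg q1 p20, mul_nonneg q1 p11, mul_nonneg q1 p02, mul_nonneg q2 p20,
    mul_nonneg q2 p11, mul_nonneg q2 p02, mul_nonneg q3 p20, mul_nonneg q3 p11, mul_nonneg q3 p02,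
    mul_nonneg q4 p20, mul_nonneg q4 p11, mul_nonneg q4 p02]

/-! ### The bilinear form -/

/-- The integrand of the scalar product of `H²_*` as a function of the second derivatives. -/
def plateDensity (ν κ a b c a' b' c' : ℝ) : ℝ :=
  ν * ((a + c) * (a' + c')) + (1 - ν) * (a * a' + 2 * (b * b') + c * c') + κ * (a * a')

theorem le_plateDensity_self {ν κ : ℝ} (hν : 0 ≤ ν) (hν1 : ν ≤ 1) (hκ : 0 ≤ κ) (a b c : ℝ) :
    (1 - ν) * (a ^ 2 + b ^ 2 + c ^ 2) ≤ plateDensity ν κ a b c a b c := by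
  unfold plateDensity
  nlinarith [mul_nonneg hν (sq_nonneg (a + c)), mul_nonneg (sub_nonneg.mpr hν1) (sq_nonneg b),
    mul_nonneg hκ (sq_nonneg a)]

theorem MemLp.integrable_mul_two {α : Type*} [MeasurableSpace α] {μ : Measure α} {f g : α → ℝ}
    (hf : MemLp f 2 μ) (hg : MemLp g 2 μ) : Integrable (fun x => f x * g x) μ :=
  MemLp.integrable_mul hf hg

theorem integrable_plateDensity {α : Type*} [MeasurableSpace α] {μ : Measure α} (ν κ : ℝ)
    {a b c a' b' c' : α → ℝ} (ha : MemLp a 2 μ) (hb : MemLp b 2 μ) (hc : MemLp c 2 μ)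
    (ha' : MemLp a' 2 μ) (hb' : MemLp b' 2 μ) (hc' : MemLp c' 2 μ) :
    Integrable (fun p => plateDensity ν κ (a p) (b p) (c p) (a' p) (b' p) (c' p)) μ := by
  unfold plateDensity
  exact (((MemLp.integrable_mul_two (ha.add hc) (ha'.add hc')).const_mul ν).add
    ((((MemLp.integrable_mul_two ha ha').add
      ((MemLp.integrable_mul_two hb hb').const_mul 2)).add
        (MemLp.integrable_mul_two hc hc')).const_mul (1 - ν))).add
    ((MemLp.integrable_mul_two ha ha').const_mul κ)

theorem integral_plateDensity {α : Type*} [MeasurableSpace α] {μ : Measure α} (ν κ : ℝ)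
    {a b c a' b' c' : α → ℝ} (ha : MemLp a 2 μ) (hb : MemLp b 2 μ) (hc : MemLp c 2 μ)
    (ha' : MemLp a' 2 μ) (hb' : MemLp b' 2 μ) (hc' : MemLp c' 2 μ) :
    ∫ p, plateDensity ν κ (a p) (b p) (c p) (a' p) (b' p) (c' p) ∂μ =
      ν * ∫ p, (a p + c p) * (a' p + c' p) ∂μ +
      (1 - ν) * (∫ p, a p * a' p ∂μ + 2 * ∫ p, b p * b' p ∂μ + ∫ p, c p * c' p ∂μ) +
      κ * ∫ p, a p * a' p ∂μ := by
  have h1 : Integrable (fun p => (a p + c p) * (a' p + c' p)) μ :=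
    MemLp.integrable_mul_two (ha.add hc) (ha'.add hc')
  have h2 := MemLp.integrable_mul_two ha ha'
  have h3 := MemLp.integrable_mul_two hb hb'
  have h4 := MemLp.integrable_mul_two hc hc'
  have h5 : Integrable (fun p => a p * a' p + 2 * (b p * b' p)) μ := h2.add (h3.const_mul 2)
  have h6 : Integrable (fun p => a p * a' p + 2 * (b p * b' p) + c p * c' p) μ := h5.add h4
  have h7 : Integrable (fun p => ν * ((a p + c p) * (a' p + c' p)) +
      (1 - ν) * (a p * a' p + 2 * (b p * b' p) + c p * c' p)) μ :=
    (h1.const_mul ν).add (h6.const_mul (1 - ν))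
  unfold plateDensity
  rw [integral_add h7 (h2.const_mul κ), integral_add (h1.const_mul ν) (h6.const_mul (1 - ν)),
    integral_const_mul, integral_const_mul, integral_const_mul, integral_add h5 h4,
    integral_add h2 (h3.const_mul 2), integral_const_mul]

/-- Weak derivatives are unique almost everywhere, so the arbitrary choice inside `weakDeriv` does
not affect the form. -/
theorem innerH2Star_eq {L ℓ ν κ : ℝ}
    {u gx gy gxx gxy gyy v hx hy hxx hxy hyy : ℝ × ℝ → ℝ}
    (h : IsJet L ℓ u gx gy gxx gxy gyy) (h' : IsJet L ℓ v hx hy hxx hxy hyy) :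
    innerH2Star (plate L ℓ) ν κ u v =
      ∫ p in plate L ℓ, plateDensity ν κ (gxx p) (gxy p) (gyy p) (hxx p) (hxy p) (hyy p) := by
  have j := h.memH2Star.isJet
  have j' := h'.memH2Star.isJet
  apply integral_congr_ae
  filter_upwards [j.xx.ae_eq h.xx, j.xy.ae_eq h.xy, j.yy.ae_eq h.yy, j'.xx.ae_eq h'.xx,
    j'.xy.ae_eq h'.xy, j'.yy.ae_eq h'.yy] with p h1 h2 h3 h4 h5 h6
  rw [h1, h2, h3, h4, h5, h6, plateDensity]

theorem IsJet.congr {L ℓ : ℝ} {u gx gy gxx gxy gyy hx hy hxx hxy hyy : ℝ × ℝ → ℝ}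
    (h : IsJet L ℓ u gx gy gxx gxy gyy)
    (e1 : gx =ᵐ[volume.restrict (plate L ℓ)] hx) (e2 : gy =ᵐ[volume.restrict (plate L ℓ)] hy)
    (e3 : gxx =ᵐ[volume.restrict (plate L ℓ)] hxx) (e4 : gxy =ᵐ[volume.restrict (plate L ℓ)] hxy)
    (e5 : gyy =ᵐ[volume.restrict (plate L ℓ)] hyy) : IsJet L ℓ u hx hy hxx hxy hyy where
  continuousOn := h.continuousOn
  left := h.left
  right := h.right
  x := ⟨(memLp_congr_ae e1).mp h.x.1, h.x.2.congr (ae_eq_refl _) e1⟩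
  y := ⟨(memLp_congr_ae e2).mp h.y.1, h.y.2.congr (ae_eq_refl _) e2⟩
  xx := ⟨(memLp_congr_ae e3).mp h.xx.1, h.xx.2.congr (ae_eq_refl _) e3⟩
  xy := ⟨(memLp_congr_ae e4).mp h.xy.1, h.xy.2.congr (ae_eq_refl _) e4⟩
  yy := ⟨(memLp_congr_ae e5).mp h.yy.1, h.yy.2.congr (ae_eq_refl _) e5⟩

/-! ### The Hilbert space of jets -/

/-- The square integrable functions on the plate. -/
abbrev PlateL2 (L ℓ : ℝ) : Type := Lp ℝ 2 (volume.restrict (plate L ℓ))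

/-- Sextuples of square integrable functions on the plate. -/
abbrev JetTuple (L ℓ : ℝ) : Type := PiLp 2 (fun _ : Fin 6 => PlateL2 L ℓ)

theorem inner_plateL2 {L ℓ : ℝ} (f g : PlateL2 L ℓ) :
    inner ℝ f g = ∫ p in plate L ℓ, f p * g p := by
  rw [L2.inner_def]
  congr 1
  ext p
  simp [mul_comm]

theorem norm_sq_plateL2 {L ℓ : ℝ} (f : PlateL2 L ℓ) :
    ‖f‖ ^ 2 = ∫ p in plate L ℓ, f p ^ 2 := by
  rw [← real_inner_self_eq_norm_sq, inner_plateL2]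
  simp [sq]

/-- The tuple `w` consists of `u ∈ H²_*` and its weak derivatives. -/
def IsJetOf {L ℓ : ℝ} (u : ℝ × ℝ → ℝ) (w : JetTuple L ℓ) : Prop :=
  u =ᵐ[volume.restrict (plate L ℓ)] w 0 ∧ IsJet L ℓ u (w 1) (w 2) (w 3) (w 4) (w 5)

section IsJetOf

variable {L ℓ : ℝ} {u v : ℝ × ℝ → ℝ} {w z : JetTuple L ℓ}

theorem IsJetOf.add (hu : IsJetOf u w) (hv : IsJetOf v z) :
    IsJetOf (fun p => u p + v p) (w + z) := by
  refine ⟨?_, (hu.2.add hv.2).congr (Lp.coeFn_add _ _).symm (Lp.coeFn_add _ _).symm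
    (Lp.coeFn_add _ _).symm (Lp.coeFn_add _ _).symm (Lp.coeFn_add _ _).symm⟩
  filter_upwards [hu.1, hv.1, Lp.coeFn_add (w 0) (z 0)] with p h1 h2 h3
  rw [h1, h2]
  exact h3.symm

theorem IsJetOf.const_smul (hu : IsJetOf u w) (r : ℝ) :
    IsJetOf (fun p => r * u p) (r • w) := by
  have hs : ∀ k, (fun p => r * w k p) =ᵐ[volume.restrict (plate L ℓ)] (r • w) k := fun k =>
    (Lp.coeFn_smul r (w k)).symm
  refine ⟨?_, (hu.2.const_mul r).congr (hs _) (hs _) (hs _) (hs _) (hs _)⟩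
  filter_upwards [hu.1, Lp.coeFn_smul r (w 0)] with p h1 h3
  rw [h1]
  exact h3.symm

theorem IsJetOf.sub (hu : IsJetOf u w) (hv : IsJetOf v z) :
    IsJetOf (fun p => u p - v p) (w - z) := by
  simpa [sub_eq_add_neg] using hu.add (hv.const_smul (-1))

theorem isJetOf_zero : IsJetOf (fun _ => 0) (0 : JetTuple L ℓ) := by
  have h0 : ∀ i j : ℕ, IsL2WeakDeriv (plate L ℓ) i j (fun _ => (0 : ℝ)) (fun _ => 0) :=
    fun i j => ⟨MemLp.zero', fun φ _ => by simp⟩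
  have hj : IsJet L ℓ (fun _ => 0) (fun _ => 0) (fun _ => 0) (fun _ => 0) (fun _ => 0)
      (fun _ => 0) :=
    ⟨continuousOn_const, fun _ _ => rfl, fun _ _ => rfl, h0 _ _, h0 _ _, h0 _ _, h0 _ _, h0 _ _⟩
  have hz := (Lp.coeFn_zero ℝ 2 (volume.restrict (plate L ℓ))).symm
  exact ⟨hz, hj.congr hz hz hz hz hz⟩

theorem IsJet.exists_isJetOf {gx gy gxx gxy gyy : ℝ × ℝ → ℝ}
    (h : IsJet L ℓ u gx gy gxx gxy gyy) : ∃ w : JetTuple L ℓ, IsJetOf u w :=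
  ⟨WithLp.toLp 2 ![h.memLp.toLp, h.x.1.toLp, h.y.1.toLp, h.xx.1.toLp, h.xy.1.toLp, h.yy.1.toLp],
    h.memLp.coeFn_toLp.symm, h.congr h.x.1.coeFn_toLp.symm h.y.1.coeFn_toLp.symm
      h.xx.1.coeFn_toLp.symm h.xy.1.coeFn_toLp.symm h.yy.1.coeFn_toLp.symm⟩

theorem norm_sq_jetTuple (w : JetTuple L ℓ) : ‖w‖ ^ 2 = ‖w 0‖ ^ 2 + ‖w 1‖ ^ 2 + ‖w 2‖ ^ 2 +
    ‖w 3‖ ^ 2 + ‖w 4‖ ^ 2 + ‖w 5‖ ^ 2 := by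
  rw [PiLp.norm_sq_eq_of_L2, Fin.sum_univ_six]

/-- Makes convergence of tuples in `L²` force uniform convergence of the continuous representatives.
-/
theorem exists_abs_le_norm (hL : 0 < L) (hℓ : 0 < ℓ) : ∃ K : ℝ, 0 < K ∧
    ∀ (u : ℝ × ℝ → ℝ) (w : JetTuple L ℓ), IsJetOf u w → ∀ p ∈ closedPlate L ℓ,
      |u p| ≤ K * ‖w‖ := by
  set D := (L / (2 * ℓ) + 1) ^ 2 * (4 * ℓ * L) with hD
  have hD0 : 0 < D := by positivity
  refine ⟨√D, Real.sqrt_pos.mpr hD0, fun u w h p hp => ?_⟩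
  have h1 := h.2.sq_apply_le hL hℓ hp
  rw [← norm_sq_plateL2, ← norm_sq_plateL2, ← hD] at h1
  have h2 : ‖w 3‖ ^ 2 + ‖w 4‖ ^ 2 ≤ ‖w‖ ^ 2 := by
    rw [norm_sq_jetTuple]
    nlinarith [sq_nonneg ‖w 0‖, sq_nonneg ‖w 1‖, sq_nonneg ‖w 2‖, sq_nonneg ‖w 5‖]
  have h3 : u p ^ 2 ≤ D * ‖w‖ ^ 2 := h1.trans (by gcongr)
  have h4 := Real.abs_le_sqrt h3
  rwa [Real.sqrt_mul hD0.le, Real.sqrt_sq (norm_nonneg _)] at h4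

end IsJetOf

/-- The elements of `H²_*`, as a subspace of the sextuples of square integrable functions. -/
def jetSpace (L ℓ : ℝ) : Submodule ℝ (JetTuple L ℓ) where
  carrier := {w | ∃ u, IsJetOf u w}
  add_mem' := fun ⟨_, hu⟩ ⟨_, hv⟩ => ⟨_, hu.add hv⟩
  zero_mem' := ⟨_, isJetOf_zero⟩
  smul_mem' := fun r _ ⟨_, hu⟩ => ⟨_, hu.const_smul r⟩

theorem tendsto_integral_mul_test {L ℓ : ℝ} {F : ℕ → PlateL2 L ℓ} {G : PlateL2 L ℓ}
    (hF : Tendsto F atTop (𝓝 G)) {φ : ℝ × ℝ → ℝ} (hφ : IsTestFunction (plate L ℓ) φ) :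
    Tendsto (fun n => ∫ p in plate L ℓ, F n p * φ p) atTop
      (𝓝 (∫ p in plate L ℓ, G p * φ p)) := by
  have hm : MemLp φ 2 (volume.restrict (plate L ℓ)) :=
    memLp_of_continuousOn_closedPlate hφ.smooth.continuous.continuousOn
  have key : ∀ g : PlateL2 L ℓ, ∫ p in plate L ℓ, g p * φ p = inner ℝ g hm.toLp := by
    intro g
    rw [inner_plateL2]
    apply integral_congr_ae
    filter_upwards [hm.coeFn_toLp] with p hp
    rw [hp]
  simp only [key]
  exact hF.inner tendsto_const_nhds

/-- Representatives of a convergent sequence converge uniformly on the closed rectangle, which keeps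
continuity and boundary values; the weak derivative identities pass to the limit because test
functions are in `L²`. -/
theorem isClosed_jetSpace {L ℓ : ℝ} (hL : 0 < L) (hℓ : 0 < ℓ) :
    IsClosed (jetSpace L ℓ : Set (JetTuple L ℓ)) := by
  apply IsSeqClosed.isClosed
  intro w z hw hz
  obtain ⟨K, hK, hbound⟩ := exists_abs_le_norm hL hℓ
  choose u hu using hw
  have hcauchy := hz.cauchySeq
  have hunif : UniformCauchySeqOn u atTop (closedPlate L ℓ) := by
    rw [Metric.uniformCauchySeqOn_iff]
    intro ε hε
    obtain ⟨N, hN⟩ := Metric.cauchySeq_iff.mp hcauchy (ε / K) (by positivity)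
    refine ⟨N, fun m hm n hn p hp => ?_⟩
    have h1 := hbound _ _ ((hu m).sub (hu n)) p hp
    have h2 := hN m hm n hn
    rw [dist_eq_norm, lt_div_iff₀ hK] at h2
    rw [Real.dist_eq]
    linarith
  have hpt : ∀ p ∈ closedPlate L ℓ, Tendsto (fun n => u n p) atTop
      (𝓝 (limUnder atTop fun n => u n p)) := fun p hp =>
    (hunif.cauchySeq hp).tendsto_limUnder
  set U : ℝ × ℝ → ℝ := fun p => limUnder atTop fun n => u n p with hU
  have htu := hunif.tendstoUniformlyOn_of_tendsto hpt
  have hzi : ∀ i, Tendsto (fun n => w n i) atTop (𝓝 (z i)) := fun i =>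
    ((PiLp.continuous_apply 2 _ i).tendsto z).comp hz
  -- The uniform limit and the `L²` limit are identified along a subsequence converging almost
  -- everywhere.
  have hUz : U =ᵐ[volume.restrict (plate L ℓ)] z 0 := by
    obtain ⟨ns, hns, hae⟩ := (tendstoInMeasure_of_tendsto_Lp (hzi 0)).exists_seq_tendsto_ae
    have hall : ∀ᵐ p ∂(volume.restrict (plate L ℓ)), ∀ n, u n p = w n 0 p :=
      ae_all_iff.mpr fun n => (hu n).1
    filter_upwards [hae, hall, ae_restrict_mem (isOpen_plate L ℓ).measurableSet] with p h1 h2 h3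
    have h4 := (hpt p (plate_subset_closedPlate L ℓ h3)).comp hns.tendsto_atTop
    have h5 : (fun n => w (ns n) 0 p) = (fun n => u n p) ∘ ns := by
      ext n; simp [h2]
    rw [h5] at h1
    exact tendsto_nhds_unique h4 h1
  have hderiv : ∀ (i j : ℕ) (k : Fin 6), (∀ n, HasWeakDeriv (plate L ℓ) i j (u n) (w n k)) →
      IsL2WeakDeriv (plate L ℓ) i j U (z k) := by
    intro i j k hk
    refine ⟨Lp.memLp _, HasWeakDeriv.congr (u := z 0) (g := z k) ?_ hUz.symm (ae_eq_refl _)⟩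
    intro φ hφ
    have h1 := tendsto_integral_mul_test (hzi 0) ((hφ.iterate_partialY j).iterate_partialX i)
    have h2 := (tendsto_integral_mul_test (hzi k) hφ).const_mul ((-1) ^ (i + j))
    refine tendsto_nhds_unique h1 (h2.congr fun n => ?_)
    exact (((hk n).congr (hu n).1 (ae_eq_refl _)) φ hφ).symm
  refine ⟨U, hUz, ⟨?_, ?_, ?_, ?_, ?_, ?_, ?_, ?_⟩⟩
  · exact htu.continuousOn (Frequently.of_forall fun n => (hu n).2.continuousOn)
  · intro y hy
    refine tendsto_nhds_unique (hpt (0, y) ⟨left_mem_Icc.mpr hL.le, Ioo_subset_Icc_self hy⟩) ?_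
    simp only [(hu _).2.left y hy]
    exact tendsto_const_nhds
  · intro y hy
    refine tendsto_nhds_unique (hpt (L, y) ⟨right_mem_Icc.mpr hL.le, Ioo_subset_Icc_self hy⟩) ?_
    simp only [(hu _).2.right y hy]
    exact tendsto_const_nhds
  · exact hderiv _ _ _ fun n => (hu n).2.x.2
  · exact hderiv _ _ _ fun n => (hu n).2.y.2
  · exact hderiv _ _ _ fun n => (hu n).2.xx.2
  · exact hderiv _ _ _ fun n => (hu n).2.xy.2
  · exact hderiv _ _ _ fun n => (hu n).2.yy.2

/-! ### Existence and uniqueness for the plate problem -/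

/-- The component of index `i`, as a linear map on `jetSpace`. -/
noncomputable def jetProj (L ℓ : ℝ) (i : Fin 6) : jetSpace L ℓ →L[ℝ] PlateL2 L ℓ :=
  (PiLp.proj 2 (fun _ : Fin 6 => PlateL2 L ℓ) i).comp (jetSpace L ℓ).subtypeL

/-- The scalar product of `L²`, as a bounded bilinear map. -/
noncomputable def innerPlateL2 (L ℓ : ℝ) : PlateL2 L ℓ →L[ℝ] PlateL2 L ℓ →L[ℝ] ℝ :=
  (isBoundedBilinearMap_inner (𝕜 := ℝ) (E := PlateL2 L ℓ)).toContinuousLinearMap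

/-- The scalar product of `H²_*`, as a bounded bilinear form on `jetSpace`. -/
noncomputable def plateForm (L ℓ ν κ : ℝ) : jetSpace L ℓ →L[ℝ] jetSpace L ℓ →L[ℝ] ℝ :=
  ν • (innerPlateL2 L ℓ).bilinearComp (jetProj L ℓ 3 + jetProj L ℓ 5)
      (jetProj L ℓ 3 + jetProj L ℓ 5) +
    (1 - ν) • ((innerPlateL2 L ℓ).bilinearComp (jetProj L ℓ 3) (jetProj L ℓ 3) +
      (2 : ℝ) • (innerPlateL2 L ℓ).bilinearComp (jetProj L ℓ 4) (jetProj L ℓ 4) +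
      (innerPlateL2 L ℓ).bilinearComp (jetProj L ℓ 5) (jetProj L ℓ 5)) +
    κ • (innerPlateL2 L ℓ).bilinearComp (jetProj L ℓ 3) (jetProj L ℓ 3)

theorem plateForm_apply (L ℓ ν κ : ℝ) (w z : jetSpace L ℓ) :
    plateForm L ℓ ν κ w z = ∫ p in plate L ℓ, plateDensity ν κ (w.1 3 p) (w.1 4 p) (w.1 5 p)
      (z.1 3 p) (z.1 4 p) (z.1 5 p) := by
  have e : ∀ f g : PlateL2 L ℓ, innerPlateL2 L ℓ f g = ∫ p in plate L ℓ, f p * g p :=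
    inner_plateL2
  have e' : innerPlateL2 L ℓ (w.1 3 + w.1 5) (z.1 3 + z.1 5) =
      ∫ p in plate L ℓ, (w.1 3 p + w.1 5 p) * (z.1 3 p + z.1 5 p) := by
    rw [e]
    apply integral_congr_ae
    filter_upwards [Lp.coeFn_add (w.1 3) (w.1 5), Lp.coeFn_add (z.1 3) (z.1 5)] with p h1 h2
    rw [h1, h2]
    rfl
  rw [integral_plateDensity ν κ (Lp.memLp _) (Lp.memLp _) (Lp.memLp _) (Lp.memLp _) (Lp.memLp _)
    (Lp.memLp _), ← e', ← e, ← e, ← e]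
  rfl

theorem isCoercive_plateForm {L ℓ ν κ : ℝ} (hL : 0 < L) (hℓ : 0 < ℓ) (hν : 0 ≤ ν) (hν1 : ν < 1)
    (hκ : 0 ≤ κ) : IsCoercive (plateForm L ℓ ν κ) := by
  obtain ⟨C, hC, hbound⟩ := exists_integral_sq_le hL hℓ
  have h1ν : 0 < 1 - ν := sub_pos.mpr hν1
  refine ⟨(1 - ν) / (C + 1), by positivity, fun w => ?_⟩
  obtain ⟨u, hu0, hu⟩ := w.2
  have h1 := hbound _ _ _ _ _ _ hu
  have e0 : ∫ p in plate L ℓ, u p ^ 2 = ∫ p in plate L ℓ, w.1 0 p ^ 2 := by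
    apply integral_congr_ae
    filter_upwards [hu0] with p hp
    rw [hp]
  rw [e0] at h1
  simp only [← norm_sq_plateL2] at h1
  have h34 : Integrable (fun p => w.1 3 p ^ 2 + w.1 4 p ^ 2) (volume.restrict (plate L ℓ)) :=
    (Lp.memLp _).integrable_sq.add (Lp.memLp _).integrable_sq
  have h2 : (1 - ν) * (‖w.1 3‖ ^ 2 + ‖w.1 4‖ ^ 2 + ‖w.1 5‖ ^ 2) ≤ plateForm L ℓ ν κ w w := by
    rw [plateForm_apply, norm_sq_plateL2, norm_sq_plateL2, norm_sq_plateL2,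
      ← integral_add (Lp.memLp _).integrable_sq (Lp.memLp _).integrable_sq,
      ← integral_add h34 (Lp.memLp _).integrable_sq, ← integral_const_mul]
    apply integral_mono
    · exact (h34.add (Lp.memLp _).integrable_sq).const_mul _
    · exact integrable_plateDensity ν κ (Lp.memLp _) (Lp.memLp _) (Lp.memLp _) (Lp.memLp _)
        (Lp.memLp _) (Lp.memLp _)
    · intro p
      exact le_plateDensity_self hν hν1.le hκ _ _ _
  have h3 := norm_sq_jetTuple w.1
  have h4 : ‖w‖ = ‖w.1‖ := rfl
  rw [h4, mul_assoc, ← sq, div_mul_eq_mul_div, div_le_iff₀ (by positivity)]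
  nlinarith

/-- Lax–Milgram on `jetSpace`, complete as a closed subspace; the load is represented through the
component of index `0`. -/
theorem exists_isPlateSolution {L ℓ d K κ ν : ℝ} {f : ℝ × ℝ → ℝ} (hL : 0 < L) (hℓ : 0 < ℓ)
    (hc : 0 < d ^ 3 * K / 12) (hν : 0 ≤ ν) (hν1 : ν < 1) (hκ : 0 ≤ κ)
    (hf : MemLp f 2 (volume.restrict (plate L ℓ))) : ∃ u, IsPlateSolution L ℓ d K κ ν f u := by
  have hcoer := isCoercive_plateForm (κ := κ) hL hℓ hν hν1 hκ
  have : CompleteSpace (jetSpace L ℓ) := (isClosed_jetSpace hL hℓ).completeSpace_coe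
  let F : jetSpace L ℓ →L[ℝ] ℝ :=
    (d ^ 3 * K / 12)⁻¹ • (innerPlateL2 L ℓ hf.toLp).comp (jetProj L ℓ 0)
  let r := (InnerProductSpace.toDual ℝ (jetSpace L ℓ)).symm F
  let w := hcoer.continuousLinearEquivOfBilin.symm r
  obtain ⟨u, hu0, hu⟩ := w.2
  refine ⟨u, hu.memH2Star, fun v hv => ?_⟩
  obtain ⟨z, hz⟩ := hv.isJet.exists_isJetOf
  have h1 : plateForm L ℓ ν κ w ⟨z, v, hz⟩ = F ⟨z, v, hz⟩ := by
    rw [← hcoer.continuousLinearEquivOfBilin_apply, ContinuousLinearEquiv.apply_symm_apply,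
      InnerProductSpace.toDual_symm_apply]
  have h2 : F ⟨z, v, hz⟩ = (d ^ 3 * K / 12)⁻¹ * ∫ p in plate L ℓ, f p * v p := by
    have : F ⟨z, v, hz⟩ = (d ^ 3 * K / 12)⁻¹ * inner ℝ hf.toLp (z 0) := rfl
    rw [this, inner_plateL2]
    congr 1
    apply integral_congr_ae
    filter_upwards [hf.coeFn_toLp, hz.1] with p h3 h4
    rw [h3, h4]
  rw [innerH2Star_eq hu hz.2, ← plateForm_apply L ℓ ν κ w ⟨z, v, hz⟩, h1, h2,
    mul_inv_cancel_left₀ hc.ne']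

/-- An element of `H²_*` with vanishing energy is zero. -/
theorem IsJet.eq_zero_of_innerH2Star {L ℓ ν κ : ℝ} {u gx gy gxx gxy gyy : ℝ × ℝ → ℝ}
    (hL : 0 < L) (hℓ : 0 < ℓ) (hν : 0 ≤ ν) (hν1 : ν < 1) (hκ : 0 ≤ κ)
    (h : IsJet L ℓ u gx gy gxx gxy gyy) (h0 : innerH2Star (plate L ℓ) ν κ u u = 0) :
    ∀ p ∈ closedPlate L ℓ, u p = 0 := by
  intro p hp
  rw [innerH2Star_eq h h] at h0
  have h1 : (1 - ν) * ((∫ p in plate L ℓ, gxx p ^ 2) + ∫ p in plate L ℓ, gxy p ^ 2) ≤ 0 := by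
    rw [← h0, ← integral_add h.xx.1.integrable_sq h.xy.1.integrable_sq, ← integral_const_mul]
    apply integral_mono
    · exact (h.xx.1.integrable_sq.add h.xy.1.integrable_sq).const_mul _
    · exact integrable_plateDensity ν κ h.xx.1 h.xy.1 h.yy.1 h.xx.1 h.xy.1 h.yy.1
    · intro p
      have := le_plateDensity_self hν hν1.le hκ (gxx p) (gxy p) (gyy p)
      nlinarith [mul_nonneg (sub_nonneg.mpr hν1.le) (sq_nonneg (gyy p))]
  have h2 : (∫ p in plate L ℓ, gxx p ^ 2) + ∫ p in plate L ℓ, gxy p ^ 2 ≤ 0 :=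
    nonpos_of_mul_nonpos_right h1 (sub_pos.mpr hν1)
  have h3 := h.sq_apply_le hL hℓ hp
  have h4 : u p ^ 2 ≤ 0 := h3.trans (mul_nonpos_of_nonneg_of_nonpos (by positivity) h2)
  exact pow_eq_zero_iff two_ne_zero |>.mp (le_antisymm h4 (sq_nonneg _))

theorem innerH2Star_sub_left {L ℓ ν κ : ℝ} {u v w : ℝ × ℝ → ℝ} (hu : MemH2Star L ℓ u)
    (hv : MemH2Star L ℓ v) (hw : MemH2Star L ℓ w) :
    innerH2Star (plate L ℓ) ν κ (fun p => u p - v p) w =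
      innerH2Star (plate L ℓ) ν κ u w - innerH2Star (plate L ℓ) ν κ v w := by
  have ju := hu.isJet
  have jv := hv.isJet
  have jw := hw.isJet
  rw [innerH2Star_eq (ju.sub jv) jw, innerH2Star_eq ju jw, innerH2Star_eq jv jw, ← integral_sub]
  · congr 1
    ext p
    unfold plateDensity
    ring
  · exact integrable_plateDensity ν κ ju.xx.1 ju.xy.1 ju.yy.1 jw.xx.1 jw.xy.1 jw.yy.1
  · exact integrable_plateDensity ν κ jv.xx.1 jv.xy.1 jv.yy.1 jw.xx.1 jw.xy.1 jw.yy.1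

theorem IsPlateSolution.eqOn {L ℓ d K κ ν : ℝ} {f u u' : ℝ × ℝ → ℝ} (hL : 0 < L) (hℓ : 0 < ℓ)
    (hc : 0 < d ^ 3 * K / 12) (hν : 0 ≤ ν) (hν1 : ν < 1) (hκ : 0 ≤ κ)
    (h : IsPlateSolution L ℓ d K κ ν f u) (h' : IsPlateSolution L ℓ d K κ ν f u') :
    EqOn u' u (closedPlate L ℓ) := by
  have hj := h'.mem.isJet.sub h.mem.isJet
  have hz := hj.eq_zero_of_innerH2Star hL hℓ hν hν1 hκ (by
    rw [innerH2Star_sub_left h'.mem h.mem hj.memH2Star]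
    have e1 := h.variational _ hj.memH2Star
    have e2 := h'.variational _ hj.memH2Star
    have e3 := e2.trans e1.symm
    rw [mul_left_cancel₀ hc.ne' e3, sub_self])
  intro p hp
  exact sub_eq_zero.mp (hz p hp)

/-! ### The hinged beam -/

/-- `ψ` is the deflection of a beam on `[0, L]`, hinged at the end points, with `ψ'''' = β`; `ψ₁`,
`ψ₂`, `ψ₃` are the derivatives of `ψ`. -/
structure IsBeamProfile (L : ℝ) (β ψ ψ₁ ψ₂ ψ₃ : ℝ → ℝ) : Prop where
  hasDerivAt : ∀ x, HasDerivAt ψ (ψ₁ x) x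
  hasDerivAt₁ : ∀ x, HasDerivAt ψ₁ (ψ₂ x) x
  hasDerivAt₂ : ∀ x, HasDerivAt ψ₂ (ψ₃ x) x
  eq_primitive : ∀ x, ψ₃ x = ψ₃ 0 + ∫ s in 0..x, β s
  left : ψ 0 = 0
  right : ψ L = 0
  left₂ : ψ₂ 0 = 0
  right₂ : ψ₂ L = 0

/-- Subtracting the mean makes the primitive vanish at both ends. Used once to get `ψ''` and once to
get `ψ`, it fixes all four constants of integration. -/
theorem exists_primitive_eq_zero {L : ℝ} (hL : 0 < L) {F : ℝ → ℝ} (hF : Continuous F) :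
    ∃ (c : ℝ) (Q : ℝ → ℝ), (∀ x, HasDerivAt Q (F x - c) x) ∧ Q 0 = 0 ∧ Q L = 0 := by
  set c := (∫ s in 0..L, F s) / L with hc
  have hc' : Continuous fun x => F x - c := hF.sub continuous_const
  refine ⟨c, fun x => ∫ s in 0..x, (F s - c), fun x => ?_, by simp, ?_⟩
  · exact intervalIntegral.integral_hasDerivAt_right (hc'.intervalIntegrable _ _)
      (hc'.stronglyMeasurableAtFilter _ _) hc'.continuousAt
  · simp only
    rw [intervalIntegral.integral_sub (hF.intervalIntegrable _ _) (by simp)]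
    simp [hc]
    field_simp
    simp

theorem exists_isBeamProfile {L : ℝ} (hL : 0 < L) {β : ℝ → ℝ} (hβ : Integrable β) :
    ∃ ψ ψ₁ ψ₂ ψ₃, IsBeamProfile L β ψ ψ₁ ψ₂ ψ₃ := by
  have hF : Continuous fun x => ∫ s in 0..x, β s :=
    intervalIntegral.continuous_primitive (fun _ _ => hβ.intervalIntegrable) 0
  obtain ⟨c, ψ₂, h1, h2, h3⟩ := exists_primitive_eq_zero hL hF
  have hψ₂ : Continuous ψ₂ := continuous_iff_continuousAt.mpr fun x => (h1 x).continuousAt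
  have hd : ∀ x, HasDerivAt (fun x => ∫ s in 0..x, ψ₂ s) (ψ₂ x) x := fun x =>
    intervalIntegral.integral_hasDerivAt_right (hψ₂.intervalIntegrable _ _)
      (hψ₂.stronglyMeasurableAtFilter _ _) hψ₂.continuousAt
  obtain ⟨c', ψ, h4, h5, h6⟩ := exists_primitive_eq_zero hL
    (continuous_iff_continuousAt.mpr fun x => (hd x).continuousAt)
  exact ⟨ψ, fun x => (∫ s in 0..x, ψ₂ s) - c', ψ₂, fun x => (∫ s in 0..x, β s) - c,
    ⟨h4, fun x => (hd x).sub_const c', h1, fun x => by simp; ring, h5, h6, h2, h3⟩⟩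

theorem derivWithin_Icc_of_hasDerivAt {L : ℝ} (hL : 0 < L) {A B B' : ℝ → ℝ}
    (hAB : EqOn A B (Icc 0 L)) (hB : ∀ x, HasDerivAt B (B' x) x) :
    EqOn (derivWithin A (Icc 0 L)) B' (Icc 0 L) := fun x hx => by
  rw [derivWithin_congr hAB (hAB hx)]
  exact (hB x).hasDerivWithinAt.derivWithin (uniqueDiffOn_Icc hL x hx)

/-- A function with the same derivative as another one up to a constant, and the same values at
the end points, is equal to it. -/
theorem eqOn_of_derivWithin_eq_add_const {L C : ℝ} (hL : 0 < L) {A B B' : ℝ → ℝ}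
    (hA : DifferentiableOn ℝ A (Icc 0 L)) (hB : ∀ x, HasDerivAt B (B' x) x)
    (h : ∀ x ∈ Icc 0 L, derivWithin A (Icc 0 L) x = B' x + C) (h0 : A 0 = B 0) (h1 : A L = B L) :
    EqOn A B (Icc 0 L) := by
  have hd : ∀ x ∈ Icc 0 L, HasDerivWithinAt (fun x => A x - B x - C * x) 0 (Icc 0 L) x := by
    intro x hx
    have e1 := (hA x hx).hasDerivWithinAt
    rw [h x hx] at e1
    have e2 := (e1.sub (hB x).hasDerivWithinAt).sub
      (((hasDerivAt_id x).const_mul C).hasDerivWithinAt (s := Icc 0 L))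
    convert! e2 using 1
    ring
  have hconst := constant_of_derivWithin_zero
    (fun x hx => (hd x hx).differentiableWithinAt)
    (fun x hx => (hd x (Ico_subset_Icc_self hx)).derivWithin
      (uniqueDiffOn_Icc hL x (Ico_subset_Icc_self hx)))
  have hC : C = 0 := by
    have := hconst L (right_mem_Icc.mpr hL.le)
    rw [h0, h1] at this
    simpa [hL.ne'] using this
  intro x hx
  have := hconst x hx
  rw [h0, hC] at this
  simp only [sub_self, zero_mul, sub_zero, mul_zero] at this
  linarith

namespace IsBeamProfile

variable {L B : ℝ} {β ψ ψ₁ ψ₂ ψ₃ q ψ' : ℝ → ℝ}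

theorem continuous₂ (h : IsBeamProfile L β ψ ψ₁ ψ₂ ψ₃) : Continuous ψ₂ :=
  continuous_iff_continuousAt.mpr fun x => (h.hasDerivAt₂ x).continuousAt

theorem continuous₃ (h : IsBeamProfile L β ψ ψ₁ ψ₂ ψ₃) (hβ : Integrable β) : Continuous ψ₃ := by
  rw [funext h.eq_primitive]
  exact continuous_const.add
    (intervalIntegral.continuous_primitive (fun _ _ => hβ.intervalIntegrable) 0)

theorem contDiff (h : IsBeamProfile L β ψ ψ₁ ψ₂ ψ₃) (hβ : Integrable β) : ContDiff ℝ 3 ψ := by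
  have d1 : deriv ψ = ψ₁ := funext fun x => (h.hasDerivAt x).deriv
  have d2 : deriv ψ₁ = ψ₂ := funext fun x => (h.hasDerivAt₁ x).deriv
  have d3 : deriv ψ₂ = ψ₃ := funext fun x => (h.hasDerivAt₂ x).deriv
  have c1 : ContDiff ℝ 1 ψ₂ := contDiff_one_iff_deriv.mpr
    ⟨fun x => (h.hasDerivAt₂ x).differentiableAt, d3 ▸ h.continuous₃ hβ⟩
  have c2 : ContDiff ℝ (1 + 1) ψ₁ := contDiff_succ_iff_deriv.mpr
    ⟨fun x => (h.hasDerivAt₁ x).differentiableAt, by simp, by rwa [d2]⟩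
  have c3 : ContDiff ℝ (1 + 1 + 1) ψ := contDiff_succ_iff_deriv.mpr
    ⟨fun x => (h.hasDerivAt x).differentiableAt, by simp, by rwa [d1]⟩
  convert! c3 using 1

theorem iteratedDerivWithin_two (h : IsBeamProfile L β ψ ψ₁ ψ₂ ψ₃) (hL : 0 < L) :
    EqOn (iteratedDerivWithin 2 ψ (Icc 0 L)) ψ₂ (Icc 0 L) := by
  have e1 : EqOn (iteratedDerivWithin 1 ψ (Icc 0 L)) ψ₁ (Icc 0 L) := by
    intro x hx
    rw [iteratedDerivWithin_one]
    exact derivWithin_Icc_of_hasDerivAt hL (fun _ _ => rfl) h.hasDerivAt hx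
  intro x hx
  rw [iteratedDerivWithin_succ]
  exact derivWithin_Icc_of_hasDerivAt hL e1 h.hasDerivAt₁ hx

theorem iteratedDerivWithin_three (h : IsBeamProfile L β ψ ψ₁ ψ₂ ψ₃) (hL : 0 < L) :
    EqOn (iteratedDerivWithin 3 ψ (Icc 0 L)) ψ₃ (Icc 0 L) := by
  intro x hx
  rw [iteratedDerivWithin_succ]
  exact derivWithin_Icc_of_hasDerivAt hL (h.iteratedDerivWithin_two hL) h.hasDerivAt₂ hx

theorem ae_hasDerivAt₃ (h : IsBeamProfile L β ψ ψ₁ ψ₂ ψ₃) (hβ : Integrable β) (hL : 0 < L) :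
    ∀ᵐ x, x ∈ Icc 0 L → HasDerivAt ψ₃ (β x) x := by
  filter_upwards [(hβ.intervalIntegrable (a := 0) (b := L)).ae_hasDerivAt_integral] with x hx hmem
  rw [funext h.eq_primitive]
  rw [uIcc_of_le hL.le] at hx
  exact (hx hmem 0 (left_mem_Icc.mpr hL.le)).const_add _

theorem absolutelyContinuousOnInterval (h : IsBeamProfile L β ψ ψ₁ ψ₂ ψ₃) (hβ : Integrable β) :
    AbsolutelyContinuousOnInterval ψ₃ 0 L := by
  rw [funext h.eq_primitive]
  exact absolutelyContinuousOnInterval_primitive _ hβ.intervalIntegrable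

theorem isHingedBeamSolution (h : IsBeamProfile L β ψ ψ₁ ψ₂ ψ₃) (hβ : Integrable β) (hL : 0 < L)
    (hq : ∀ᵐ x ∂(volume.restrict (Ioo 0 L)), B * β x = q x) :
    IsHingedBeamSolution L B q ψ where
  contDiffOn := (h.contDiff hβ).contDiffOn
  absolutelyContinuous := by
    have hac := h.absolutelyContinuousOnInterval hβ
    -- The iterated derivative agrees with `ψ₃` only on `[0, L]`; the definition sees only values
    -- there.
    rw [absolutelyContinuousOnInterval_iff] at hac ⊢
    intro ε hε
    obtain ⟨δ, hδ, H⟩ := hac ε hε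
    refine ⟨δ, hδ, fun E hE hlt => ?_⟩
    refine lt_of_le_of_lt (le_of_eq ?_) (H E hE hlt)
    apply Finset.sum_congr rfl
    intro i hi
    have hmem := hE.1 i hi
    rw [uIcc_of_le hL.le] at hmem
    rw [h.iteratedDerivWithin_three hL hmem.1, h.iteratedDerivWithin_three hL hmem.2]
  equation := by
    filter_upwards [hq, ae_restrict_of_ae (h.ae_hasDerivAt₃ hβ hL),
      ae_restrict_mem measurableSet_Ioo] with x h1 h2 hx
    have hx' := Ioo_subset_Icc_self hx
    rw [← h1, iteratedDerivWithin_succ,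
      derivWithin_congr (h.iteratedDerivWithin_three hL) (h.iteratedDerivWithin_three hL hx'),
      (h2 hx').hasDerivWithinAt.derivWithin (uniqueDiffOn_Icc hL x hx')]
  left := h.left
  right := h.right
  left_two := by rw [h.iteratedDerivWithin_two hL (left_mem_Icc.mpr hL.le), h.left₂]
  right_two := by rw [h.iteratedDerivWithin_two hL (right_mem_Icc.mpr hL.le), h.right₂]

/-- The third derivatives differ by an absolutely continuous function with zero derivative almost
everywhere, that is, by a constant. The end conditions remove the constant, first for the second
derivatives and then for the functions. -/
theorem eqOn (h : IsBeamProfile L β ψ ψ₁ ψ₂ ψ₃) (hβ : Integrable β) (hL : 0 < L) (hB : B ≠ 0)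
    (hq : ∀ᵐ x ∂(volume.restrict (Ioo 0 L)), B * β x = q x)
    (h' : IsHingedBeamSolution L B q ψ') : EqOn ψ' ψ (Icc 0 L) := by
  have hu := uniqueDiffOn_Icc hL
  obtain ⟨C, hC⟩ : ∃ C, ∀ x ∈ Icc 0 L, iteratedDerivWithin 3 ψ' (Icc 0 L) x = ψ₃ x + C := by
    obtain ⟨C, hC⟩ := (h'.absolutelyContinuous.sub
      (h.absolutelyContinuousOnInterval hβ)).const_of_ae_hasDerivAt_zero (by
        have e1 := h'.equation
        rw [ae_restrict_iff' measurableSet_Ioo] at e1 hq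
        filter_upwards [e1, hq, h.ae_hasDerivAt₃ hβ hL,
          h'.absolutelyContinuous.ae_differentiableAt, Measure.ae_ne volume 0,
          Measure.ae_ne volume L] with x h1 h2 h3 h4 h5 h6 hx
        have hx' : x ∈ Icc 0 L := by rwa [uIcc_of_le hL.le] at hx
        have hxo : x ∈ Ioo 0 L := ⟨lt_of_le_of_ne hx'.1 (Ne.symm h5), lt_of_le_of_ne hx'.2 h6⟩
        have h7 := (h4 hx).hasDerivAt
        have h8 := h7.hasDerivWithinAt.derivWithin (hu x hx')
        have h9 := h1 hxo
        rw [iteratedDerivWithin_succ, h8, ← h2 hxo] at h9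
        rw [mul_left_cancel₀ hB h9] at h7
        simpa using h7.sub (h3 hx'))
    refine ⟨C, fun x hx => ?_⟩
    have := hC x (by rwa [uIcc_of_le hL.le])
    simp only [Pi.sub_apply] at this
    linarith
  have h2 : EqOn (iteratedDerivWithin 2 ψ' (Icc 0 L)) ψ₂ (Icc 0 L) := by
    refine eqOn_of_derivWithin_eq_add_const (C := C) hL
      (h'.contDiffOn.differentiableOn_iteratedDerivWithin (by norm_num) hu) h.hasDerivAt₂
      (fun x hx => ?_) (h'.left_two.trans h.left₂.symm) (h'.right_two.trans h.right₂.symm)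
    rw [← iteratedDerivWithin_succ]
    exact hC x hx
  obtain ⟨C₁, hC₁⟩ : ∃ C, ∀ x ∈ Icc 0 L, derivWithin ψ' (Icc 0 L) x = ψ₁ x + C := by
    have hd : ∀ x ∈ Icc 0 L,
        HasDerivWithinAt (fun x => iteratedDerivWithin 1 ψ' (Icc 0 L) x - ψ₁ x) 0 (Icc 0 L) x := by
      intro x hx
      have e1 := (h'.contDiffOn.differentiableOn_iteratedDerivWithin (m := 1) (by norm_num) hu
        x hx).hasDerivWithinAt
      rw [← iteratedDerivWithin_succ, h2 hx] at e1
      have e2 := e1.fun_sub (h.hasDerivAt₁ x).hasDerivWithinAt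
      rwa [sub_self] at e2
    have hconst := constant_of_derivWithin_zero
      (fun x hx => (hd x hx).differentiableWithinAt)
      (fun x hx => (hd x (Ico_subset_Icc_self hx)).derivWithin (hu x (Ico_subset_Icc_self hx)))
    refine ⟨iteratedDerivWithin 1 ψ' (Icc 0 L) 0 - ψ₁ 0, fun x hx => ?_⟩
    rw [← hconst x hx, iteratedDerivWithin_one]
    ring
  exact eqOn_of_derivWithin_eq_add_const hL (h'.contDiffOn.differentiableOn (by norm_num))
    h.hasDerivAt hC₁ (h'.left.trans h.left.symm) (h'.right.trans h.right.symm)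

end IsBeamProfile

/-! ### Products of functions of one variable -/

theorem memLp_mul_continuous {L ℓ : ℝ} {A q : ℝ → ℝ} (hA : MemLp A 2 (volume.restrict (Ioo 0 L)))
    (hq : Continuous q) :
    MemLp (fun p : ℝ × ℝ => A p.1 * q p.2) 2 (volume.restrict (plate L ℓ)) := by
  obtain ⟨C, hC⟩ := (isCompact_Icc (a := -ℓ) (b := ℓ)).exists_bound_of_continuousOn
    hq.continuousOn
  have h1 : MemLp (fun p : ℝ × ℝ => A p.1) 2 (volume.restrict (plate L ℓ)) := by
    rw [plate, restrict_prod_eq]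
    exact hA.comp_fst _
  refine (h1.mul_const C).mono (h1.aestronglyMeasurable.mul
    (hq.comp continuous_snd).aestronglyMeasurable) ?_
  filter_upwards [ae_rectangle_mem measurableSet_Ioo measurableSet_Ioo] with p hp
  rw [norm_mul, norm_mul]
  gcongr
  exact (hC p.2 (Ioo_subset_Icc_self hp.2)).trans (Real.le_norm_self _)

theorem memLp_restrict_Ioo_of_continuous {L : ℝ} {A : ℝ → ℝ} (hA : Continuous A) :
    MemLp A 2 (volume.restrict (Ioo 0 L)) := by
  obtain ⟨C, hC⟩ := (isCompact_Icc (a := 0) (b := L)).exists_bound_of_continuousOn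
    hA.continuousOn
  refine MemLp.of_bound hA.aestronglyMeasurable C ?_
  filter_upwards [ae_restrict_mem measurableSet_Ioo] with x hx
  exact hC x (Ioo_subset_Icc_self hx)

theorem hasWeakDeriv_mul_x {L ℓ : ℝ} (hL : 0 < L) {A A' q : ℝ → ℝ} (hAc : Continuous A)
    (hA' : MemLp A' 2 (volume.restrict (Ioo 0 L))) (hq : Continuous q)
    (h : ∀ x, A x = A 0 + ∫ s in 0..x, A' s) :
    HasWeakDeriv (plate L ℓ) 1 0 (fun p => A p.1 * q p.2) (fun p => A' p.1 * q p.2) := by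
  refine hasWeakDeriv_of_eq_primX (k := fun y => A 0 * q y) hL.le
    ((memLp_mul_continuous (memLp_restrict_Ioo_of_continuous hAc) hq).integrable one_le_two)
    ((memLp_mul_continuous hA' hq).integrable one_le_two) (ae_of_all _ fun p => ?_)
  simp only [primX, intervalIntegral.integral_mul_const]
  rw [h p.1]
  ring

theorem hasWeakDeriv_mul_y {L ℓ : ℝ} (hℓ : 0 < ℓ) {A q q' : ℝ → ℝ}
    (hA : MemLp A 2 (volume.restrict (Ioo 0 L))) (hq : ∀ y, HasDerivAt q (q' y) y)
    (hq' : Continuous q') :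
    HasWeakDeriv (plate L ℓ) 0 1 (fun p => A p.1 * q p.2) (fun p => A p.1 * q' p.2) := by
  have hqc : Continuous q := continuous_iff_continuousAt.mpr fun y => (hq y).continuousAt
  have h1 : HasWeakDeriv (Ioo (-ℓ) ℓ ×ˢ Ioo 0 L) 1 0 (fun p => A p.2 * q p.1)
      (fun p => A p.2 * q' p.1) := by
    refine hasWeakDeriv_of_eq_primX (k := fun x => A x * q (-ℓ)) (by linarith)
      (integrableOn_comp_swap ((memLp_mul_continuous hA hqc).integrable one_le_two))
      (integrableOn_comp_swap ((memLp_mul_continuous hA hq').integrable one_le_two))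
      (ae_of_all _ fun p => ?_)
    simp only [primX, intervalIntegral.integral_const_mul]
    rw [intervalIntegral.integral_eq_sub_of_hasDerivAt (fun y _ => hq y)
      (hq'.intervalIntegrable _ _)]
    ring
  exact h1.comp_swap'

/-- The jet of a product of functions of one variable. -/
theorem isJet_mul {L ℓ : ℝ} (hL : 0 < L) (hℓ : 0 < ℓ) {A A₁ A₂ q q₁ q₂ : ℝ → ℝ}
    (hA : ∀ x, HasDerivAt A (A₁ x) x) (hA₁ : Continuous A₁)
    (hA₂ : MemLp A₂ 2 (volume.restrict (Ioo 0 L))) (h : ∀ x, A₁ x = A₁ 0 + ∫ s in 0..x, A₂ s)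
    (hA0 : A 0 = 0) (hAL : A L = 0) (hq : ∀ y, HasDerivAt q (q₁ y) y)
    (hq₁ : ∀ y, HasDerivAt q₁ (q₂ y) y) (hq₂ : Continuous q₂) :
    IsJet L ℓ (fun p => A p.1 * q p.2) (fun p => A₁ p.1 * q p.2) (fun p => A p.1 * q₁ p.2)
      (fun p => A₂ p.1 * q p.2) (fun p => A₁ p.1 * q₁ p.2) (fun p => A p.1 * q₂ p.2) := by
  have hqc : Continuous q := continuous_iff_continuousAt.mpr fun y => (hq y).continuousAt
  have hq₁c : Continuous q₁ := continuous_iff_continuousAt.mpr fun y => (hq₁ y).continuousAt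
  have hAc : Continuous A := continuous_iff_continuousAt.mpr fun y => (hA y).continuousAt
  have mA := memLp_restrict_Ioo_of_continuous (L := L) hAc
  have mA₁ := memLp_restrict_Ioo_of_continuous (L := L) hA₁
  have hx : HasWeakDeriv (plate L ℓ) 1 0 (fun p => A p.1 * q p.2) (fun p => A₁ p.1 * q p.2) :=
    hasWeakDeriv_mul_x hL hAc mA₁ hqc fun x => by
      rw [intervalIntegral.integral_eq_sub_of_hasDerivAt (fun y _ => hA y)
        (hA₁.intervalIntegrable _ _)]
      ring
  have hy : HasWeakDeriv (plate L ℓ) 0 1 (fun p => A p.1 * q p.2) (fun p => A p.1 * q₁ p.2) :=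
    hasWeakDeriv_mul_y hℓ mA hq hq₁c
  refine ⟨?_, fun y _ => by simp [hA0], fun y _ => by simp [hAL],
    ⟨memLp_mul_continuous mA₁ hqc, hx⟩, ⟨memLp_mul_continuous mA hq₁c, hy⟩,
    ⟨memLp_mul_continuous hA₂ hqc, hx.trans (hasWeakDeriv_mul_x hL hA₁ hA₂ hqc h)⟩,
    ⟨memLp_mul_continuous mA₁ hq₁c, hx.trans (hasWeakDeriv_mul_y hℓ mA₁ hq hq₁c)⟩,
    ⟨memLp_mul_continuous mA hq₂, hy.trans (hasWeakDeriv_mul_y hℓ mA hq₁ hq₂)⟩⟩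
  exact ((hAc.comp continuous_fst).mul (hqc.comp continuous_snd)).continuousOn

/-! ### Comparison of the plate with the beam -/

namespace IsBeamProfile

variable {L ℓ : ℝ} {β ψ ψ₁ ψ₂ ψ₃ : ℝ → ℝ}

/-- The corrected beam profile `ψ(x) - ν y² ψ''(x) / 2`. -/
theorem isJet (h : IsBeamProfile L β ψ ψ₁ ψ₂ ψ₃) (hL : 0 < L) (hℓ : 0 < ℓ) (hβ : Integrable β)
    (hβ2 : MemLp β 2 (volume.restrict (Ioo 0 L))) (ν : ℝ) :
    ∃ Ux Uy : ℝ × ℝ → ℝ, IsJet L ℓ (fun p => ψ p.1 - ν / 2 * p.2 ^ 2 * ψ₂ p.1) Ux Uy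
      (fun p => ψ₂ p.1 - ν / 2 * p.2 ^ 2 * β p.1) (fun p => -(ν * p.2 * ψ₃ p.1))
      (fun p => -(ν * ψ₂ p.1)) := by
  have c₁ : Continuous ψ₁ := continuous_iff_continuousAt.mpr fun x => (h.hasDerivAt₁ x).continuousAt
  have j1 := isJet_mul hL hℓ (q := fun _ => 1) (q₁ := fun _ => 0) (q₂ := fun _ => 0)
    h.hasDerivAt c₁ (memLp_restrict_Ioo_of_continuous h.continuous₂) (fun x => by
      rw [intervalIntegral.integral_eq_sub_of_hasDerivAt (fun y _ => h.hasDerivAt₁ y)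
        (h.continuous₂.intervalIntegrable _ _)]
      ring) h.left h.right (fun y => hasDerivAt_const y 1) (fun y => hasDerivAt_const y 0)
    continuous_const
  have j2 := isJet_mul hL hℓ (q := fun y => y ^ 2) (q₁ := fun y => 2 * y) (q₂ := fun _ => 2)
    h.hasDerivAt₂ (h.continuous₃ hβ) hβ2 h.eq_primitive h.left₂ h.right₂
    (fun y => by simpa using hasDerivAt_pow 2 y)
    (fun y => by simpa using (hasDerivAt_id y).const_mul 2) continuous_const
  refine ⟨fun p => ψ₁ p.1 - ν / 2 * p.2 ^ 2 * ψ₃ p.1, fun p => -(ν * p.2 * ψ₂ p.1), ?_⟩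
  convert! j1.sub (j2.const_mul (ν / 2)) using 1 <;> (ext p; ring)

/-- The weak form of the beam equation, tested with elements of `H²_*`. -/
theorem integral_mul_xx (h : IsBeamProfile L β ψ ψ₁ ψ₂ ψ₃) (hL : 0 < L) (hβ : Integrable β)
    (hβ2 : MemLp β 2 (volume.restrict (Ioo 0 L)))
    {v vx vy vxx vxy vyy : ℝ × ℝ → ℝ} (hv : IsJet L ℓ v vx vy vxx vxy vyy) :
    ∫ p in plate L ℓ, ψ₂ p.1 * vxx p = ∫ p in plate L ℓ, β p.1 * v p := by
  have m1 : MemLp (fun p : ℝ × ℝ => ψ₂ p.1) 2 (volume.restrict (plate L ℓ)) := by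
    simpa using memLp_mul_continuous (L := L) (ℓ := ℓ)
      (memLp_restrict_Ioo_of_continuous h.continuous₂) (continuous_const (y := (1 : ℝ)))
  have m2 : MemLp (fun p : ℝ × ℝ => β p.1) 2 (volume.restrict (plate L ℓ)) := by
    simpa using memLp_mul_continuous (L := L) (ℓ := ℓ) hβ2 (continuous_const (y := (1 : ℝ)))
  have i1 := MemLp.integrable_mul_two m1 hv.xx.1
  have i2 := MemLp.integrable_mul_two m2 hv.memLp
  have ixx : IntegrableOn vxx (Ioo 0 L ×ˢ Ioo (-ℓ) ℓ) := hv.xx.1.integrable one_le_two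
  have ix : IntegrableOn vx (Ioo 0 L ×ˢ Ioo (-ℓ) ℓ) := hv.x.1.integrable one_le_two
  rw [plate, restrict_prod_eq] at i1 i2 ⊢
  rw [integral_prod_symm _ i1, integral_prod_symm _ i2]
  obtain ⟨k, -, hk⟩ := hv.hasWeakDeriv_x_x.exists_eq_primX hL isOpen_Ioo ix ixx
  apply integral_congr_ae
  filter_upwards [hv.eq_primitive hL, ae_ae_of_ae_rectangle hk, ae_integrableOn_slice ixx,
    ae_restrict_mem measurableSet_Ioo] with y h1 h2 h3 hy
  have jxx : IntervalIntegrable (fun x => vxx (x, y)) volume 0 L :=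
    (intervalIntegrable_iff_Ioo hL.le).mpr h3
  -- The absolutely continuous representative of `v_x` on this slice.
  set Q : ℝ → ℝ := fun x => k y + ∫ s in 0..x, vxx (s, y) with hQ
  have hQv : ∀ x ∈ Icc 0 L, v (x, y) = 0 + ∫ s in 0..x, Q s := by
    intro x hx
    rw [h1 x hx, zero_add]
    apply intervalIntegral.integral_congr_ae
    rw [ae_restrict_iff' measurableSet_Ioo] at h2
    filter_upwards [h2, Measure.ae_ne volume L] with s hs hsL hmem
    rw [uIoc_of_le hx.1] at hmem
    exact hs ⟨hmem.1, lt_of_le_of_ne (hmem.2.trans hx.2) hsL⟩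
  have jQ : IntervalIntegrable Q volume 0 L := by
    apply ContinuousOn.intervalIntegrable_of_Icc hL.le
    exact continuousOn_const.add (continuousOn_primitive_Icc hL.le h3)
  have jψ₃ : IntervalIntegrable ψ₃ volume 0 L := (h.continuous₃ hβ).intervalIntegrable _ _
  -- Two integrations by parts. The boundary terms of the first vanish because `ψ₂` is zero at the
  -- ends, those of the second because `v` is.
  have p1 := integral_primitive_mul_primitive 0 (k y) jψ₃ jxx
  have p2 := integral_primitive_mul_primitive (ψ₃ 0) 0 (hβ.intervalIntegrable (a := 0) (b := L)) jQ
  have e2 : ∀ x, ψ₂ x = 0 + ∫ s in 0..x, ψ₃ s := by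
    intro x
    rw [intervalIntegral.integral_eq_sub_of_hasDerivAt (fun y _ => h.hasDerivAt₂ y)
      ((h.continuous₃ hβ).intervalIntegrable _ _), h.left₂]
    ring
  simp only [← e2, h.right₂] at p1
  simp only [← h.eq_primitive] at p2
  have eL : (0 : ℝ) + ∫ s in 0..L, Q s = 0 := by
    rw [← hQv L (right_mem_Icc.mpr hL.le), hv.right y hy]
  rw [eL] at p2
  have p3 : ∫ x in 0..L, β x * (0 + ∫ s in 0..x, Q s) = ∫ x in 0..L, β x * v (x, y) := by
    apply intervalIntegral.integral_congr
    intro x hx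
    rw [uIcc_of_le hL.le] at hx
    simp only [hQv x hx]
  rw [p3] at p2
  rw [← intervalIntegral_eq_setIntegral_Ioo hL.le, ← intervalIntegral_eq_setIntegral_Ioo hL.le]
  linarith

end IsBeamProfile

/-! ### Energy estimate for the corrected profile. -/

theorem mul_le_half_sq_add {δ : ℝ} (hδ : 0 < δ) (X a : ℝ) :
    X * a ≤ δ / 2 * a ^ 2 + X ^ 2 / (2 * δ) := by
  have : δ / 2 * a ^ 2 + X ^ 2 / (2 * δ) - X * a = (δ * a - X) ^ 2 / (2 * δ) := by
    field_simp
    ring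
  have h2 : 0 ≤ (δ * a - X) ^ 2 / (2 * δ) := by positivity
  linarith

/-- The constant in the energy estimate for the difference of the plate and the beam. -/
noncomputable def energyConst (ν κ : ℝ) : ℝ :=
  ((ν / 2 * (1 + κ)) ^ 2 + (ν / 2 * ν) ^ 2 + (2 * (1 - ν) * ν) ^ 2) / (2 * (1 - ν))

/-- Here `s`, `t`, `β` stand for `ψ''`, `ψ'''`, `ψ''''`, and `a`, `b`, `c` for the second
derivatives of the error. All terms in `s` cancel; what remains is linear in `a`, `b`, `c` with
coefficients of size `y² β` and `y t`. Young's inequality with weight `1 - ν` spends half of the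
coercivity on it, and `ℓ ≤ 1` reduces `y⁴` to `ℓ²`. -/
theorem plateDensity_corrector_le {ν κ ℓ y : ℝ} (hν : 0 ≤ ν) (hν1 : ν < 1) (hκ : 0 ≤ κ)
    (hℓ1 : ℓ ≤ 1) (hy : |y| ≤ ℓ) (s t β a b c : ℝ) :
    (1 - ν) / 2 * (a ^ 2 + b ^ 2) - energyConst ν κ * ℓ ^ 2 * (β ^ 2 + t ^ 2) ≤
      plateDensity ν κ a b c a b c - ((κ + 1 - ν ^ 2) * (s * a) -
        plateDensity ν κ (s - ν / 2 * y ^ 2 * β) (-(ν * y * t)) (-(ν * s)) a b c) := by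
  have hδ : 0 < 1 - ν := sub_pos.mpr hν1
  have h0 := le_plateDensity_self hν hν1.le hκ a b c
  have hy2 : y ^ 2 ≤ ℓ ^ 2 := by
    rw [← sq_abs]
    exact pow_le_pow_left₀ (abs_nonneg _) hy 2
  have hℓ0 : 0 ≤ ℓ := (abs_nonneg _).trans hy
  have hℓ2 : ℓ ^ 2 ≤ 1 := pow_le_one₀ hℓ0 hℓ1
  have hy4 : (y ^ 2) ^ 2 ≤ ℓ ^ 2 := by nlinarith [sq_nonneg y]
  have e1 : (κ + 1 - ν ^ 2) * (s * a) -
        plateDensity ν κ (s - ν / 2 * y ^ 2 * β) (-(ν * y * t)) (-(ν * s)) a b c =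
      (ν / 2 * (1 + κ) * y ^ 2 * β) * a + (ν / 2 * ν * y ^ 2 * β) * c +
        (2 * (1 - ν) * ν * y * t) * b := by
    unfold plateDensity
    ring
  have y1 := mul_le_half_sq_add hδ (ν / 2 * (1 + κ) * y ^ 2 * β) a
  have y2 := mul_le_half_sq_add hδ (ν / 2 * ν * y ^ 2 * β) c
  have y3 := mul_le_half_sq_add hδ (2 * (1 - ν) * ν * y * t) b
  have z1 : (ν / 2 * (1 + κ) * y ^ 2 * β) ^ 2 ≤ (ν / 2 * (1 + κ)) ^ 2 * (ℓ ^ 2 * (β ^ 2 + t ^ 2)) := by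
    rw [show (ν / 2 * (1 + κ) * y ^ 2 * β) ^ 2 =
      (ν / 2 * (1 + κ)) ^ 2 * ((y ^ 2) ^ 2 * β ^ 2) by ring]
    gcongr
    nlinarith [sq_nonneg t]
  have z2 : (ν / 2 * ν * y ^ 2 * β) ^ 2 ≤ (ν / 2 * ν) ^ 2 * (ℓ ^ 2 * (β ^ 2 + t ^ 2)) := by
    rw [show (ν / 2 * ν * y ^ 2 * β) ^ 2 = (ν / 2 * ν) ^ 2 * ((y ^ 2) ^ 2 * β ^ 2) by ring]
    gcongr
    nlinarith [sq_nonneg t]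
  have z3 : (2 * (1 - ν) * ν * y * t) ^ 2 ≤ (2 * (1 - ν) * ν) ^ 2 * (ℓ ^ 2 * (β ^ 2 + t ^ 2)) := by
    rw [show (2 * (1 - ν) * ν * y * t) ^ 2 = (2 * (1 - ν) * ν) ^ 2 * (y ^ 2 * t ^ 2) by ring]
    gcongr
    nlinarith [sq_nonneg β]
  have z : (ν / 2 * (1 + κ) * y ^ 2 * β) ^ 2 / (2 * (1 - ν)) +
      (ν / 2 * ν * y ^ 2 * β) ^ 2 / (2 * (1 - ν)) +
      (2 * (1 - ν) * ν * y * t) ^ 2 / (2 * (1 - ν)) ≤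
      energyConst ν κ * ℓ ^ 2 * (β ^ 2 + t ^ 2) := by
    have e : energyConst ν κ * ℓ ^ 2 * (β ^ 2 + t ^ 2) =
        ((ν / 2 * (1 + κ)) ^ 2 * (ℓ ^ 2 * (β ^ 2 + t ^ 2)) +
          (ν / 2 * ν) ^ 2 * (ℓ ^ 2 * (β ^ 2 + t ^ 2)) +
          (2 * (1 - ν) * ν) ^ 2 * (ℓ ^ 2 * (β ^ 2 + t ^ 2))) / (2 * (1 - ν)) := by
      unfold energyConst
      ring
    rw [e, ← add_div, ← add_div]
    exact div_le_div_of_nonneg_right (by linarith) (by linarith)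
  rw [e1]
  linarith [mul_nonneg hδ.le (sq_nonneg c)]

theorem setIntegral_plate_comp_fst {L ℓ : ℝ} (hℓ : 0 < ℓ) {G : ℝ → ℝ} :
    ∫ p in plate L ℓ, G p.1 = 2 * ℓ * ∫ x in Ioo 0 L, G x := by
  have := integral_prod_mul (μ := volume.restrict (Ioo 0 L)) (ν := volume.restrict (Ioo (-ℓ) ℓ))
    G (fun _ => (1 : ℝ))
  rw [plate, restrict_prod_eq]
  simp only [mul_one] at this
  rw [this]
  simp [hℓ.le]
  ring

theorem IsPlateSolution.innerH2Star_eq_beam {L ℓ d K κ ν : ℝ} {f u : ℝ × ℝ → ℝ}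
    {β ψ ψ₁ ψ₂ ψ₃ : ℝ → ℝ} (hu : IsPlateSolution L ℓ d K κ ν f u)
    (h : IsBeamProfile L β ψ ψ₁ ψ₂ ψ₃) (hL : 0 < L) (hc : 0 < d ^ 3 * K / 12)
    (hβ : Integrable β) (hβ2 : MemLp β 2 (volume.restrict (Ioo 0 L)))
    (hfβ : ∀ᵐ p ∂(volume.restrict (plate L ℓ)),
      d ^ 3 * K / 12 * (κ + 1 - ν ^ 2) * β p.1 = f p)
    {v vx vy vxx vxy vyy : ℝ × ℝ → ℝ} (hv : IsJet L ℓ v vx vy vxx vxy vyy) :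
    innerH2Star (plate L ℓ) ν κ u v =
      (κ + 1 - ν ^ 2) * ∫ p in plate L ℓ, ψ₂ p.1 * vxx p := by
  apply mul_left_cancel₀ hc.ne'
  rw [hu.variational v hv.memH2Star, h.integral_mul_xx hL hβ hβ2 hv, ← mul_assoc,
    ← integral_const_mul]
  apply integral_congr_ae
  filter_upwards [hfβ] with p hp
  rw [← hp]
  ring

/-- Quantitative comparison of the plate with the beam. -/
theorem IsBeamProfile.exists_abs_sub_le {L d K κ ν : ℝ} {f β ψ ψ₁ ψ₂ ψ₃ : ℝ → ℝ}
    (h : IsBeamProfile L β ψ ψ₁ ψ₂ ψ₃) (hL : 0 < L) (hc : 0 < d ^ 3 * K / 12)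
    (hν : 0 ≤ ν) (hν1 : ν < 1) (hκ : 0 ≤ κ)
    (hβ : Integrable β) (hβ2 : MemLp β 2 (volume.restrict (Ioo 0 L)))
    (hfβ : ∀ᵐ x ∂(volume.restrict (Ioo 0 L)), d ^ 3 * K / 12 * (κ + 1 - ν ^ 2) * β x = f x) :
    ∃ C : ℝ, ∀ ℓ, 0 < ℓ → ℓ ≤ 1 → ∀ u, IsPlateSolution L ℓ d K κ ν (fun p => f p.1) u →
      ∀ p ∈ plate L ℓ, |u p - ψ p.1| ≤ C * ℓ := by
  have hδ : 0 < 1 - ν := sub_pos.mpr hν1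
  set Z := ∫ x in Ioo 0 L, (β x ^ 2 + ψ₃ x ^ 2) with hZ
  have hZ0 : 0 ≤ Z := integral_nonneg fun x => by positivity
  set M := energyConst ν κ with hM
  have hM0 : 0 ≤ M := by rw [hM, energyConst]; positivity
  obtain ⟨S, hS⟩ := (isCompact_Icc (a := 0) (b := L)).exists_bound_of_continuousOn
    h.continuous₂.continuousOn
  set D := (L / 2 + 1) ^ 2 * (16 * L * M * Z / (1 - ν)) with hD
  refine ⟨√D + ν / 2 * S, fun ℓ hℓ hℓ1 u hu p hp => ?_⟩
  obtain ⟨Ux, Uy, hU⟩ := h.isJet hL hℓ hβ hβ2 ν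
  set U : ℝ × ℝ → ℝ := fun p => ψ p.1 - ν / 2 * p.2 ^ 2 * ψ₂ p.1 with hUdef
  have hW := hu.mem.isJet.sub hU
  generalize hwx : (fun p => weakDeriv (plate L ℓ) 1 0 u p - Ux p) = wx at hW
  generalize hwy : (fun p => weakDeriv (plate L ℓ) 0 1 u p - Uy p) = wy at hW
  generalize hwxx : (fun p : ℝ × ℝ => weakDeriv (plate L ℓ) 2 0 u p - _) = wxx at hW
  generalize hwxy : (fun p : ℝ × ℝ => weakDeriv (plate L ℓ) 1 1 u p - _) = wxy at hW
  generalize hwyy : (fun p : ℝ × ℝ => weakDeriv (plate L ℓ) 0 2 u p - _) = wyy at hW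
  -- The energy of `W` is `(u, W) - (U, W)`, and the beam equation rewrites `(u, W)` as the leading
  -- part of `(U, W)`.
  have hE1 := innerH2Star_sub_left (ν := ν) (κ := κ) hu.mem hU.memH2Star hW.memH2Star
  rw [hu.innerH2Star_eq_beam h hL hc hβ hβ2 (ae_of_ae_slice' hfβ) hW, innerH2Star_eq hU hW,
    innerH2Star_eq hW hW] at hE1
  have m2 : MemLp (fun p : ℝ × ℝ => ψ₂ p.1) 2 (volume.restrict (plate L ℓ)) := by
    simpa using memLp_mul_continuous (L := L) (ℓ := ℓ)
      (memLp_restrict_Ioo_of_continuous h.continuous₂) (continuous_const (y := (1 : ℝ)))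
  have m3 : MemLp (fun p : ℝ × ℝ => ψ₃ p.1) 2 (volume.restrict (plate L ℓ)) := by
    simpa using memLp_mul_continuous (L := L) (ℓ := ℓ)
      (memLp_restrict_Ioo_of_continuous (h.continuous₃ hβ)) (continuous_const (y := (1 : ℝ)))
  have mβ : MemLp (fun p : ℝ × ℝ => β p.1) 2 (volume.restrict (plate L ℓ)) := by
    simpa using memLp_mul_continuous (L := L) (ℓ := ℓ) hβ2 (continuous_const (y := (1 : ℝ)))
  have i1 := integrable_plateDensity ν κ hW.xx.1 hW.xy.1 hW.yy.1 hW.xx.1 hW.xy.1 hW.yy.1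
  have i2 := (MemLp.integrable_mul_two m2 hW.xx.1).const_mul (κ + 1 - ν ^ 2)
  have i3 := integrable_plateDensity ν κ hU.xx.1 hU.xy.1 hU.yy.1 hW.xx.1 hW.xy.1 hW.yy.1
  have i4 : Integrable (fun p => (1 - ν) / 2 * (wxx p ^ 2 + wxy p ^ 2))
      (volume.restrict (plate L ℓ)) :=
    (hW.xx.1.integrable_sq.add hW.xy.1.integrable_sq).const_mul _
  have i5 : Integrable (fun p : ℝ × ℝ => M * ℓ ^ 2 * (β p.1 ^ 2 + ψ₃ p.1 ^ 2))
      (volume.restrict (plate L ℓ)) :=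
    (mβ.integrable_sq.add m3.integrable_sq).const_mul _
  have hE2 := integral_mono_ae (i4.sub i5) (i1.sub (i2.sub i3)) (by
    filter_upwards [ae_restrict_mem (isOpen_plate L ℓ).measurableSet] with q hq
    exact plateDensity_corrector_le hν hν1 hκ hℓ1 (abs_le.mpr ⟨hq.2.1.le, hq.2.2.le⟩) _ _ _ _ _ _)
  rw [integral_sub' i4 i5, integral_sub' i1 (i2.sub i3), integral_sub' i2 i3, integral_const_mul,
    integral_const_mul, integral_const_mul, hE1, sub_self,
    integral_add hW.xx.1.integrable_sq hW.xy.1.integrable_sq,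
    setIntegral_plate_comp_fst (G := fun x => β x ^ 2 + ψ₃ x ^ 2) hℓ, ← hZ] at hE2
  -- The third power is `ℓ ^ 2` from the remainder times the factor `2 * ℓ` from integrating over
  -- the width.
  have hN : (∫ p in plate L ℓ, wxx p ^ 2) + ∫ p in plate L ℓ, wxy p ^ 2 ≤
      4 * M * Z / (1 - ν) * ℓ ^ 3 := by
    rw [div_mul_eq_mul_div, le_div_iff₀ hδ]
    linarith
  have hcl := plate_subset_closedPlate L ℓ hp
  have hW2 : (u p - U p) ^ 2 ≤ D * ℓ ^ 2 := by
    refine (hW.sq_apply_le hL hℓ hcl).trans ?_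
    calc (L / (2 * ℓ) + 1) ^ 2 * (4 * ℓ * L) *
        ((∫ p in plate L ℓ, wxx p ^ 2) + ∫ p in plate L ℓ, wxy p ^ 2)
        ≤ (L / (2 * ℓ) + 1) ^ 2 * (4 * ℓ * L) * (4 * M * Z / (1 - ν) * ℓ ^ 3) := by gcongr
      _ = (L / 2 + ℓ) ^ 2 * (16 * L * M * Z / (1 - ν)) * ℓ ^ 2 := by field_simp; ring
      _ ≤ D * ℓ ^ 2 := by rw [hD]; gcongr
  have h1 : |u p - U p| ≤ √D * ℓ := by
    have := Real.abs_le_sqrt hW2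
    rwa [Real.sqrt_mul (by positivity), Real.sqrt_sq hℓ.le] at this
  have h2 : |U p - ψ p.1| ≤ ν / 2 * S * ℓ := by
    have e : U p - ψ p.1 = -(ν / 2 * p.2 ^ 2 * ψ₂ p.1) := by rw [hUdef]; ring
    have hy : |p.2| ≤ ℓ := abs_le.mpr ⟨hp.2.1.le, hp.2.2.le⟩
    have hy2 : p.2 ^ 2 ≤ ℓ := by
      rw [← sq_abs]
      nlinarith [abs_nonneg p.2]
    have hs : |ψ₂ p.1| ≤ S := hS p.1 (Ioo_subset_Icc_self hp.1)
    rw [e, abs_neg, abs_mul, abs_of_nonneg (by positivity)]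
    calc ν / 2 * p.2 ^ 2 * |ψ₂ p.1| ≤ ν / 2 * ℓ * S := by gcongr
      _ = ν / 2 * S * ℓ := by ring
  calc |u p - ψ p.1| ≤ |u p - U p| + |U p - ψ p.1| := abs_sub_le _ _ _
    _ ≤ (√D + ν / 2 * S) * ℓ := by linarith

end OrthotropicPlate

theorem theorem4p1
    (L d E₁ E₂ ν₁₂ ν₂₁ E : ℝ) (hL : 0 < L) (hd : 0 < d)
    (hE₂ : 0 < E₂) (hE₁₂ : E₂ < E₁)
    (hν_pos : 0 < ν₁₂) (hν_lt : ν₁₂ < 1 / 2)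
    (hsymm : ν₂₁ / E₂ = ν₁₂ / E₁)
    (hE : E = (OrthotropicPlate.coeffKappa E₁ E₂ + 1 - ν₁₂ ^ 2) *
      OrthotropicPlate.coeffK E₂ ν₁₂ ν₂₁)
    (f : ℝ → ℝ) (hf : MemLp f 2 (volume.restrict (Ioo 0 L))) :
    -- for every half-width the plate problem has exactly one solution
    (∀ ℓ : ℝ, 0 < ℓ → ∃ u : ℝ × ℝ → ℝ,
      OrthotropicPlate.IsPlateSolution L ℓ d (OrthotropicPlate.coeffK E₂ ν₁₂ ν₂₁)
        (OrthotropicPlate.coeffKappa E₁ E₂) ν₁₂ (fun p => f p.1) u ∧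
      ∀ u' : ℝ × ℝ → ℝ,
        OrthotropicPlate.IsPlateSolution L ℓ d (OrthotropicPlate.coeffK E₂ ν₁₂ ν₂₁)
          (OrthotropicPlate.coeffKappa E₁ E₂) ν₁₂ (fun p => f p.1) u' →
        EqOn u' u (OrthotropicPlate.closedPlate L ℓ)) ∧
    ∃ ψ : ℝ → ℝ,
      -- `ψ` is the unique solution of the hinged beam problem, whatever the half-width
      (∀ ℓ : ℝ, 0 < ℓ →
        OrthotropicPlate.IsHingedBeamSolution L (E * OrthotropicPlate.momentOfInertia d ℓ)
          (fun x => 2 * ℓ * f x) ψ ∧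
        ∀ ψ' : ℝ → ℝ,
          OrthotropicPlate.IsHingedBeamSolution L (E * OrthotropicPlate.momentOfInertia d ℓ)
            (fun x => 2 * ℓ * f x) ψ' →
          EqOn ψ' ψ (Icc 0 L)) ∧
      -- uniform convergence of the plate solutions to the beam solution
      ∀ u : ℝ → ℝ × ℝ → ℝ,
        (∀ ℓ : ℝ, 0 < ℓ →
          OrthotropicPlate.IsPlateSolution L ℓ d (OrthotropicPlate.coeffK E₂ ν₁₂ ν₂₁)
            (OrthotropicPlate.coeffKappa E₁ E₂) ν₁₂ (fun p => f p.1) (u ℓ)) →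
        Tendsto
          (fun ℓ : ℝ => ⨆ p ∈ OrthotropicPlate.plate L ℓ, ENNReal.ofReal |u ℓ p - ψ p.1|)
          (𝓝[>] 0) (𝓝 0) := by
  have hE₁ : 0 < E₁ := hE₂.trans hE₁₂
  set κ := OrthotropicPlate.coeffKappa E₁ E₂ with hκdef
  set K := OrthotropicPlate.coeffK E₂ ν₁₂ ν₂₁ with hKdef
  have hκ : 0 ≤ κ := div_nonneg (sub_nonneg.mpr hE₁₂.le) hE₂.le
  have hK : 0 < K := by
    have h1 : ν₂₁ = ν₁₂ / E₁ * E₂ := by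
      rw [← hsymm]
      field_simp
    have h2 : ν₁₂ * ν₂₁ < 1 := by
      have h3 : ν₂₁ < ν₁₂ := by
        rw [h1, div_mul_eq_mul_div, div_lt_iff₀ hE₁]
        exact mul_lt_mul_of_pos_left hE₁₂ hν_pos
      nlinarith
    exact div_pos hE₂ (sub_pos.mpr h2)
  have hc : 0 < d ^ 3 * K / 12 := by positivity
  have hΓ : 0 < κ + 1 - ν₁₂ ^ 2 := by nlinarith
  have hν1 : ν₁₂ < 1 := by linarith
  refine ⟨fun ℓ hℓ => ?_, ?_⟩
  · have hfp : MemLp (fun p : ℝ × ℝ => f p.1) 2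
        (volume.restrict (OrthotropicPlate.plate L ℓ)) := by
      rw [OrthotropicPlate.plate, OrthotropicPlate.restrict_prod_eq]
      exact hf.comp_fst _
    obtain ⟨u, hu⟩ := OrthotropicPlate.exists_isPlateSolution hL hℓ hc hν_pos.le hν1 hκ hfp
    exact ⟨u, hu, fun u' hu' => hu.eqOn hL hℓ hc hν_pos.le hν1 hκ hu'⟩
  set γ := d ^ 3 * K / 12 * (κ + 1 - ν₁₂ ^ 2) with hγ
  have hγ0 : 0 < γ := mul_pos hc hΓ
  -- Extension by zero makes `β` integrable on the whole line, so the beam profile can be built on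
  -- `ℝ`.
  set β : ℝ → ℝ := (Ioo 0 L).indicator fun x => γ⁻¹ * f x with hβdef
  have hfβ : ∀ᵐ x ∂(volume.restrict (Ioo 0 L)), γ * β x = f x := by
    filter_upwards [ae_restrict_mem measurableSet_Ioo] with x hx
    rw [hβdef, indicator_of_mem hx, mul_inv_cancel_left₀ hγ0.ne']
  have hβ2 : MemLp β 2 (volume.restrict (Ioo 0 L)) := (hf.const_mul γ⁻¹).indicator measurableSet_Ioo
  have hβ : Integrable β :=
    (integrable_indicator_iff measurableSet_Ioo).mpr ((hf.const_mul γ⁻¹).integrable one_le_two)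
  obtain ⟨ψ, ψ₁, ψ₂, ψ₃, hψ⟩ := OrthotropicPlate.exists_isBeamProfile hL hβ
  refine ⟨ψ, fun ℓ hℓ => ?_, fun u hu => ?_⟩
  · have hB : E * OrthotropicPlate.momentOfInertia d ℓ = 2 * ℓ * γ := by
      rw [hE, OrthotropicPlate.momentOfInertia, hγ]
      ring
    have hq : ∀ᵐ x ∂(volume.restrict (Ioo 0 L)),
        E * OrthotropicPlate.momentOfInertia d ℓ * β x = 2 * ℓ * f x := by
      filter_upwards [hfβ] with x hx
      rw [hB, mul_assoc, hx]
    have hB0 : E * OrthotropicPlate.momentOfInertia d ℓ ≠ 0 := by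
      rw [hB]
      positivity
    exact ⟨hψ.isHingedBeamSolution hβ hL hq, fun ψ' h' => hψ.eqOn hβ hL hB0 hq h'⟩
  · obtain ⟨C, hC⟩ := hψ.exists_abs_sub_le hL hc hν_pos.le hν1 hκ hβ hβ2 hfβ
    have hlim : Tendsto (fun ℓ : ℝ => ENNReal.ofReal (C * ℓ)) (𝓝[>] 0) (𝓝 0) := by
      have h1 : Tendsto (fun ℓ : ℝ => C * ℓ) (𝓝[>] 0) (𝓝 (C * 0)) :=
        ((continuous_const.mul continuous_id).tendsto 0).mono_left nhdsWithin_le_nhds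
      simpa using ENNReal.tendsto_ofReal h1
    refine tendsto_of_tendsto_of_tendsto_of_le_of_le' tendsto_const_nhds hlim
      (Eventually.of_forall fun _ => zero_le) ?_
    filter_upwards [Ioo_mem_nhdsGT (zero_lt_one (α := ℝ))] with ℓ hℓ
    exact iSup₂_le fun p hp =>
      ENNReal.ofReal_le_ofReal (hC ℓ hℓ.1 hℓ.2.le (u ℓ) (hu ℓ hℓ.1) p hp)
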